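/- Let $\Omega$ be the category of finite rooted trees: its objects are the finite rooted trees (possibly with leaves and with nullary vertices), and a morphism $S\to T$ is a map $\Omega(S)\to\Omega(T)$ between the associated free symmetric coloured operads. A dendroidal set is a presheaf of sets on $\Omega$; $\Omega[T]$ denotes the presheaf represented by $T$, and $\partial\Omega[T]\subseteq\Omega[T]$ its boundary, the union of all proper faces of $T$. Let $\otimes$ be the tensor product of dendroidal sets, that is, the functor preserving colimits in each variable with $\Omega[S]\otimes\Omega[T]=N_d(\Omega(S)\otimes_{BV}\Omega(T))$, where $\otimes_{BV}$ is the Boardman–Vogt tensor product of operads and $N_d$ is the dendroidal nerve. A dendroidal set $X$ is normal if $\mathrm{Aut}(R)$ acts freely on $X(R)$ for every tree $R$, and a monomorphism $X\to Y$ is normal if, for every tree $R$, $\mathrm{Aut}(R)$ acts freely on the complement of the image of $X(R)$ in $Y(R)$. A tree is open if it has no nullary vertices. Let $S$ and $T$ be open trees. Then the canonical map from the pushout $$\Omega[S]\otimes\partial\Omega[T]\ \cup_{\partial\Omega[S]\otimes\partial\Omega[T]}\ \partial\Omega[S]\otimes\Omega[T]\ \longrightarrow\ \Omega[S]\otimes\Omega[T]$$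 is a monomorphism. Moreover $\Omega[S]\otimes\Omega[T]$ is normal, so that this map is a normal monomorphism. -/

import Mathlib

open CategoryTheory

namespace Dendroidal

/-! ### Symmetric coloured operads -/

/-- A symmetric coloured operad in sets. Arities are finite types `I`, so that an element of
`Op c d` is an operation with inputs `c i` (`i : I`) and output `d`; the symmetric group actions
are the relabellings `reindex` along bijections of arities. Operations can be composed along all
inputs at once. -/
structure SymOperad where
  Colour : Type
  Op : {I : Type} → [Finite I] → (I → Colour) → Colour → Type 1
  unit (d : Colour) : Op (fun _ : Unit => d) d
  reindex {I J : Type} [Finite I] [Finite J] (σ : I ≃ J) {c : J → Colour} {d : Colour} :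
    Op (fun i => c (σ i)) d → Op c d
  comp {I : Type} [Finite I] {J : I → Type} [∀ i, Finite (J i)] {b : ∀ i, J i → Colour}
    {c : I → Colour} {d : Colour} (p : Op c d) (q : ∀ i, Op (b i) (c i)) :
    Op (fun x : Σ i, J i => b x.1 x.2) d
  reindex_refl {I : Type} [Finite I] {c : I → Colour} {d : Colour} (p : Op c d) :
    reindex (Equiv.refl I) p = p
  reindex_reindex {I J K : Type} [Finite I] [Finite J] [Finite K] (σ : I ≃ J) (τ : J ≃ K)
    {c : K → Colour} {d : Colour} (p : Op (fun i => c (τ (σ i))) d) :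
    reindex τ (reindex (c := fun j => c (τ j)) σ p) = reindex (σ.trans τ) p
  reindex_comp {I I' : Type} [Finite I] [Finite I'] (σ : I ≃ I') {J : I' → Type}
    [∀ i, Finite (J i)] {b : ∀ i, J i → Colour} {c : I' → Colour} {d : Colour}
    (p : Op (fun i => c (σ i)) d) (q : ∀ i, Op (b i) (c i)) :
    comp (reindex σ p) q =
      reindex (Equiv.sigmaCongrLeft (β := J) σ) (comp p (fun i => q (σ i)))
  comp_reindex {I : Type} [Finite I] {J J' : I → Type} [∀ i, Finite (J i)]
    [∀ i, Finite (J' i)] (σ : ∀ i, J i ≃ J' i) {b : ∀ i, J' i → Colour} {c : I → Colour}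
    {d : Colour} (p : Op c d) (q : ∀ i, Op (fun j => b i (σ i j)) (c i)) :
    comp p (fun i => reindex (σ i) (q i)) =
      reindex (c := fun x : Σ i, J' i => b x.1 x.2) (Equiv.sigmaCongrRight σ) (comp p q)
  unit_comp {J : Type} [Finite J] {b : J → Colour} {d : Colour} (q : Op b d) :
    comp (unit d) (fun _ => q) =
      reindex (c := fun x : Σ _ : Unit, J => b x.2)
        (Equiv.uniqueSigma (fun _ : Unit => J)).symm q
  comp_unit {I : Type} [Finite I] {c : I → Colour} {d : Colour} (p : Op c d) :
    comp p (fun i => unit (c i)) =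
      reindex (c := fun x : Σ _ : I, Unit => c x.1)
        (Equiv.sigmaUnique I (fun _ => Unit)).symm p
  assoc {I : Type} [Finite I] {J : I → Type} [∀ i, Finite (J i)] {K : ∀ i, J i → Type}
    [∀ i j, Finite (K i j)] {a : ∀ i j, K i j → Colour} {b : ∀ i, J i → Colour}
    {c : I → Colour} {d : Colour} (p : Op c d) (q : ∀ i, Op (b i) (c i))
    (r : ∀ i j, Op (a i j) (b i j)) :
    reindex (c := fun x : Σ i, Σ j, K i j => a x.1 x.2.1 x.2.2) (Equiv.sigmaAssoc K)
        (comp (comp p q) (fun x => r x.1 x.2)) =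
      comp p (fun i => comp (q i) (r i))

/-- A map of symmetric coloured operads. -/
@[ext]
structure SymOperad.Hom (P Q : SymOperad) where
  colour : P.Colour → Q.Colour
  onOp : {I : Type} → [Finite I] → {c : I → P.Colour} → {d : P.Colour} →
    P.Op c d → Q.Op (fun i => colour (c i)) (colour d)
  onOp_unit (d : P.Colour) : onOp (P.unit d) = Q.unit (colour d)
  onOp_reindex {I J : Type} [Finite I] [Finite J] (σ : I ≃ J) {c : J → P.Colour} {d : P.Colour}
    (p : P.Op (fun i => c (σ i)) d) :
    onOp (P.reindex σ p) = Q.reindex (c := fun j => colour (c j)) σ (onOp p)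
  onOp_comp {I : Type} [Finite I] {J : I → Type} [∀ i, Finite (J i)] {b : ∀ i, J i → P.Colour}
    {c : I → P.Colour} {d : P.Colour} (p : P.Op c d) (q : ∀ i, P.Op (b i) (c i)) :
    onOp (P.comp p q) = Q.comp (onOp p) (fun i => onOp (q i))

instance : Category SymOperad where
  Hom := SymOperad.Hom
  id P :=
    { colour := fun c => c
      onOp := fun p => p
      onOp_unit := fun _ => rfl
      onOp_reindex := fun _ _ _ _ => rfl
      onOp_comp := fun _ _ => rfl }
  comp f g :=
    { colour := fun c => g.colour (f.colour c)
      onOp := fun p => g.onOp (f.onOp p)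
      onOp_unit := fun d => by rw [f.onOp_unit, g.onOp_unit]
      onOp_reindex := fun σ _ _ p => by rw [f.onOp_reindex, g.onOp_reindex]
      onOp_comp := fun p q => by rw [f.onOp_comp, g.onOp_comp] }

/-! ### The Boardman-Vogt tensor product -/

/-- Formal operadic composites of the operations `p ⊗ y` and `x ⊗ q`. -/
inductive BVTerm (P Q : SymOperad) :
    {I : Type} → [Finite I] → (I → P.Colour × Q.Colour) → P.Colour × Q.Colour → Type 1
  | left {I : Type} [Finite I] {c : I → P.Colour} {d : P.Colour} (p : P.Op c d)
      (y : Q.Colour) : BVTerm P Q (fun i => (c i, y)) (d, y)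
  | right {J : Type} [Finite J] {c : J → Q.Colour} {d : Q.Colour} (x : P.Colour)
      (q : Q.Op c d) : BVTerm P Q (fun j => (x, c j)) (x, d)
  | unit (d : P.Colour × Q.Colour) : BVTerm P Q (fun _ : Unit => d) d
  | reindex {I J : Type} [Finite I] [Finite J] (σ : I ≃ J) {c : J → P.Colour × Q.Colour}
      {d : P.Colour × Q.Colour} (p : BVTerm P Q (fun i => c (σ i)) d) : BVTerm P Q c d
  | comp {I : Type} [Finite I] {J : I → Type} [∀ i, Finite (J i)]
      {b : ∀ i, J i → P.Colour × Q.Colour} {c : I → P.Colour × Q.Colour}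
      {d : P.Colour × Q.Colour} (p : BVTerm P Q c d) (q : ∀ i, BVTerm P Q (b i) (c i)) :
      BVTerm P Q (fun x : Σ i, J i => b x.1 x.2) d

/-- The congruence on formal composites generated by the operad axioms, by the requirement that
`- ⊗ y` and `x ⊗ -` are operad maps, and by the interchange relation. -/
inductive BVRel (P Q : SymOperad) : {I : Type} → [Finite I] → {c : I → P.Colour × Q.Colour} →
    {d : P.Colour × Q.Colour} → BVTerm P Q c d → BVTerm P Q c d → Prop
  -- it is an equivalence relation and a congruence
  | refl {I : Type} [Finite I] {c : I → P.Colour × Q.Colour} {d : P.Colour × Q.Colour}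
      (p : BVTerm P Q c d) : BVRel P Q p p
  | symm {I : Type} [Finite I] {c : I → P.Colour × Q.Colour} {d : P.Colour × Q.Colour}
      {p p' : BVTerm P Q c d} : BVRel P Q p p' → BVRel P Q p' p
  | trans {I : Type} [Finite I] {c : I → P.Colour × Q.Colour} {d : P.Colour × Q.Colour}
      {p p' p'' : BVTerm P Q c d} : BVRel P Q p p' → BVRel P Q p' p'' → BVRel P Q p p''
  | reindex_congr {I J : Type} [Finite I] [Finite J] (σ : I ≃ J)
      {c : J → P.Colour × Q.Colour} {d : P.Colour × Q.Colour}
      {p p' : BVTerm P Q (fun i => c (σ i)) d} :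
      BVRel P Q p p' → BVRel P Q (.reindex σ p) (.reindex σ p')
  | comp_congr {I : Type} [Finite I] {J : I → Type} [∀ i, Finite (J i)]
      {b : ∀ i, J i → P.Colour × Q.Colour} {c : I → P.Colour × Q.Colour}
      {d : P.Colour × Q.Colour} {p p' : BVTerm P Q c d} {q q' : ∀ i, BVTerm P Q (b i) (c i)} :
      BVRel P Q p p' → (∀ i, BVRel P Q (q i) (q' i)) → BVRel P Q (.comp p q) (.comp p' q')
  -- the operad axioms
  | reindex_refl {I : Type} [Finite I] {c : I → P.Colour × Q.Colour}
      {d : P.Colour × Q.Colour} (p : BVTerm P Q c d) :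
      BVRel P Q (.reindex (Equiv.refl I) p) p
  | reindex_reindex {I J K : Type} [Finite I] [Finite J] [Finite K] (σ : I ≃ J) (τ : J ≃ K)
      {c : K → P.Colour × Q.Colour} {d : P.Colour × Q.Colour}
      (p : BVTerm P Q (fun i => c (τ (σ i))) d) :
      BVRel P Q (.reindex τ (.reindex (c := fun j => c (τ j)) σ p)) (.reindex (σ.trans τ) p)
  | reindex_comp {I I' : Type} [Finite I] [Finite I'] (σ : I ≃ I') {J : I' → Type}
      [∀ i, Finite (J i)] {b : ∀ i, J i → P.Colour × Q.Colour} {c : I' → P.Colour × Q.Colour}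
      {d : P.Colour × Q.Colour} (p : BVTerm P Q (fun i => c (σ i)) d)
      (q : ∀ i, BVTerm P Q (b i) (c i)) :
      BVRel P Q (.comp (.reindex σ p) q)
        (.reindex (Equiv.sigmaCongrLeft (β := J) σ) (.comp p (fun i => q (σ i))))
  | comp_reindex {I : Type} [Finite I] {J J' : I → Type} [∀ i, Finite (J i)]
      [∀ i, Finite (J' i)] (σ : ∀ i, J i ≃ J' i) {b : ∀ i, J' i → P.Colour × Q.Colour}
      {c : I → P.Colour × Q.Colour} {d : P.Colour × Q.Colour} (p : BVTerm P Q c d)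
      (q : ∀ i, BVTerm P Q (fun j => b i (σ i j)) (c i)) :
      BVRel P Q (.comp p (fun i => .reindex (σ i) (q i)))
        (.reindex (c := fun x : Σ i, J' i => b x.1 x.2) (Equiv.sigmaCongrRight σ) (.comp p q))
  | unit_comp {J : Type} [Finite J] {b : J → P.Colour × Q.Colour} {d : P.Colour × Q.Colour}
      (q : BVTerm P Q b d) :
      BVRel P Q (.comp (.unit d) (fun _ => q))
        (.reindex (c := fun x : Σ _ : Unit, J => b x.2)
          (Equiv.uniqueSigma (fun _ : Unit => J)).symm q)
  | comp_unit {I : Type} [Finite I] {c : I → P.Colour × Q.Colour} {d : P.Colour × Q.Colour}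
      (p : BVTerm P Q c d) :
      BVRel P Q (.comp p (fun i => .unit (c i)))
        (.reindex (c := fun x : Σ _ : I, Unit => c x.1)
          (Equiv.sigmaUnique I (fun _ => Unit)).symm p)
  | assoc {I : Type} [Finite I] {J : I → Type} [∀ i, Finite (J i)] {K : ∀ i, J i → Type}
      [∀ i j, Finite (K i j)] {a : ∀ i j, K i j → P.Colour × Q.Colour}
      {b : ∀ i, J i → P.Colour × Q.Colour} {c : I → P.Colour × Q.Colour}
      {d : P.Colour × Q.Colour} (p : BVTerm P Q c d) (q : ∀ i, BVTerm P Q (b i) (c i))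
      (r : ∀ i j, BVTerm P Q (a i j) (b i j)) :
      BVRel P Q
        (.reindex (c := fun x : Σ i, Σ j, K i j => a x.1 x.2.1 x.2.2) (Equiv.sigmaAssoc K)
          (.comp (.comp p q) (fun x => r x.1 x.2)))
        (.comp p (fun i => .comp (q i) (r i)))
  -- `- ⊗ y` is an operad map
  | left_unit (x : P.Colour) (y : Q.Colour) : BVRel P Q (.left (P.unit x) y) (.unit (x, y))
  | left_reindex {I J : Type} [Finite I] [Finite J] (σ : I ≃ J) {c : J → P.Colour}
      {d : P.Colour} (p : P.Op (fun i => c (σ i)) d) (y : Q.Colour) :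
      BVRel P Q (.left (P.reindex σ p) y) (.reindex (c := fun j => (c j, y)) σ (.left p y))
  | left_comp {I : Type} [Finite I] {J : I → Type} [∀ i, Finite (J i)]
      {b : ∀ i, J i → P.Colour} {c : I → P.Colour} {d : P.Colour} (p : P.Op c d)
      (q : ∀ i, P.Op (b i) (c i)) (y : Q.Colour) :
      BVRel P Q (.left (P.comp p q) y) (.comp (.left p y) (fun i => .left (q i) y))
  -- `x ⊗ -` is an operad map
  | right_unit (x : P.Colour) (y : Q.Colour) : BVRel P Q (.right x (Q.unit y)) (.unit (x, y))
  | right_reindex {I J : Type} [Finite I] [Finite J] (σ : I ≃ J) {c : J → Q.Colour}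
      {d : Q.Colour} (x : P.Colour) (q : Q.Op (fun i => c (σ i)) d) :
      BVRel P Q (.right x (Q.reindex σ q)) (.reindex (c := fun j => (x, c j)) σ (.right x q))
  | right_comp {I : Type} [Finite I] {J : I → Type} [∀ i, Finite (J i)]
      {b : ∀ i, J i → Q.Colour} {c : I → Q.Colour} {d : Q.Colour} (x : P.Colour)
      (p : Q.Op c d) (q : ∀ i, Q.Op (b i) (c i)) :
      BVRel P Q (.right x (Q.comp p q)) (.comp (.right x p) (fun i => .right x (q i)))
  -- interchange: `(p ⊗ d') ∘ (c i ⊗ q)ᵢ = (d ⊗ q) ∘ (p ⊗ c' j)ⱼ` up to reordering the inputs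
  | interchange {I J : Type} [Finite I] [Finite J] {c : I → P.Colour} {d : P.Colour}
      {c' : J → Q.Colour} {d' : Q.Colour} (p : P.Op c d) (q : Q.Op c' d') :
      BVRel P Q
        (.reindex (c := fun x : Σ _ : J, I => (c x.2, c' x.1))
          ⟨fun x : Σ _ : I, J => ⟨x.2, x.1⟩, fun x => ⟨x.2, x.1⟩, fun _ => rfl, fun _ => rfl⟩
          (.comp (.left p d') (fun i => .right (c i) q)))
        (.comp (.right d q) (fun j => .left p (c' j)))

instance BVTerm.setoid (P Q : SymOperad) {I : Type} [Finite I] (c : I → P.Colour × Q.Colour)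
    (d : P.Colour × Q.Colour) : Setoid (BVTerm P Q c d) where
  r := BVRel P Q
  iseqv := ⟨.refl, .symm, .trans⟩

/-- Composition of classes of formal composites. -/
noncomputable def bvComp {P Q : SymOperad} {I : Type} [Finite I] {J : I → Type}
    [∀ i, Finite (J i)] {b : ∀ i, J i → P.Colour × Q.Colour} {c : I → P.Colour × Q.Colour}
    {d : P.Colour × Q.Colour} (p : Quotient (BVTerm.setoid P Q c d))
    (q : ∀ i, Quotient (BVTerm.setoid P Q (b i) (c i))) :
    Quotient (BVTerm.setoid P Q (fun x : Σ i, J i => b x.1 x.2) d) :=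
  Quotient.mk _ (.comp p.out (fun i => (q i).out))

theorem bvComp_mk {P Q : SymOperad} {I : Type} [Finite I] {J : I → Type}
    [∀ i, Finite (J i)] {b : ∀ i, J i → P.Colour × Q.Colour} {c : I → P.Colour × Q.Colour}
    {d : P.Colour × Q.Colour} (p : BVTerm P Q c d) (q : ∀ i, BVTerm P Q (b i) (c i)) :
    bvComp (Quotient.mk _ p) (fun i => Quotient.mk _ (q i)) = Quotient.mk _ (.comp p q) :=
  Quotient.sound (.comp_congr (Quotient.mk_out p) (fun i => Quotient.mk_out (q i)))

/-- Relabelling of the inputs of a class of formal composites. -/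
def bvReindex {P Q : SymOperad} {I J : Type} [Finite I] [Finite J] (σ : I ≃ J)
    {c : J → P.Colour × Q.Colour} {d : P.Colour × Q.Colour} :
    Quotient (BVTerm.setoid P Q (fun i => c (σ i)) d) → Quotient (BVTerm.setoid P Q c d) :=
  Quotient.map (.reindex σ) (fun _ _ h => .reindex_congr σ h)

theorem bv_exists_rep {P Q : SymOperad} {I : Type} {J : I → Type} [∀ i, Finite (J i)]
    {b : ∀ i, J i → P.Colour × Q.Colour} {c : I → P.Colour × Q.Colour}
    (q : ∀ i, Quotient (BVTerm.setoid P Q (b i) (c i))) :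
    ∃ q' : ∀ i, BVTerm P Q (b i) (c i), q = fun i => Quotient.mk _ (q' i) :=
  ⟨fun i => (q i).out, funext fun i => (Quotient.out_eq (q i)).symm⟩

/-- The Boardman-Vogt tensor product of operads. -/
noncomputable def bvTensor (P Q : SymOperad) : SymOperad where
  Colour := P.Colour × Q.Colour
  Op := fun c d => Quotient (BVTerm.setoid P Q c d)
  unit d := Quotient.mk _ (.unit d)
  reindex σ := bvReindex σ
  comp p q := bvComp p q
  reindex_refl p := by
    induction p using Quotient.inductionOn
    exact Quotient.sound (.reindex_refl _)
  reindex_reindex σ τ _ _ p := by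
    induction p using Quotient.inductionOn
    exact Quotient.sound (.reindex_reindex σ τ _)
  reindex_comp σ _ _ _ _ _ p q := by
    induction p using Quotient.inductionOn
    obtain ⟨q, rfl⟩ := bv_exists_rep q
    rw [bvComp_mk]
    erw [bvComp_mk]
    exact Quotient.sound (.reindex_comp σ _ _)
  comp_reindex σ _ _ _ p q := by
    induction p using Quotient.inductionOn
    obtain ⟨q, rfl⟩ := bv_exists_rep q
    rw [bvComp_mk]
    erw [bvComp_mk]
    exact Quotient.sound (.comp_reindex σ _ _)
  unit_comp q := by
    induction q using Quotient.inductionOn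
    exact (bvComp_mk _ _).trans (Quotient.sound (.unit_comp _))
  comp_unit p := by
    induction p using Quotient.inductionOn
    exact (bvComp_mk _ _).trans (Quotient.sound (.comp_unit _))
  assoc p q r := by
    induction p using Quotient.inductionOn
    obtain ⟨q, rfl⟩ := bv_exists_rep q
    obtain ⟨r, rfl⟩ : ∃ r' : ∀ i j, BVTerm P Q _ _, r = fun i j => Quotient.mk _ (r' i j) :=
      ⟨fun i j => (r i j).out, funext fun i => funext fun j => (Quotient.out_eq (r i j)).symm⟩
    rw [bvComp_mk]
    erw [bvComp_mk]
    simp only [bvComp_mk]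
    exact Quotient.sound (.assoc _ _ _)

/-- The effect of a pair of operad maps on formal composites. -/
def BVTerm.map {P P' Q Q' : SymOperad} (f : P ⟶ P') (g : Q ⟶ Q') :
    {I : Type} → [Finite I] → {c : I → P.Colour × Q.Colour} → {d : P.Colour × Q.Colour} →
    BVTerm P Q c d →
      BVTerm P' Q' (fun i => (f.colour (c i).1, g.colour (c i).2)) (f.colour d.1, g.colour d.2)
  | _, _, _, _, @BVTerm.left _ _ _ _ _ _ p y => .left (f.onOp p) (g.colour y)
  | _, _, _, _, @BVTerm.right _ _ _ _ _ _ x q => .right (f.colour x) (g.onOp q)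
  | _, _, _, _, .unit d => .unit (f.colour d.1, g.colour d.2)
  | _, _, _, _, @BVTerm.reindex _ _ _ _ _ _ σ c _ p =>
      .reindex (c := fun j => (f.colour (c j).1, g.colour (c j).2)) σ (BVTerm.map f g p)
  | _, _, _, _, @BVTerm.comp _ _ _ _ _ _ _ _ _ p q =>
      .comp (BVTerm.map f g p) (fun i => BVTerm.map f g (q i))

theorem BVTerm.map_rel {P P' Q Q' : SymOperad} (f : P ⟶ P') (g : Q ⟶ Q') {I : Type} [Finite I]
    {c : I → P.Colour × Q.Colour} {d : P.Colour × Q.Colour} {p p' : BVTerm P Q c d}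
    (h : BVRel P Q p p') : BVRel P' Q' (p.map f g) (p'.map f g) := by
  induction h with
  | refl p => exact .refl _
  | symm _ ih => exact .symm ih
  | trans _ _ ih ih' => exact .trans ih ih'
  | reindex_congr σ _ ih => exact .reindex_congr σ ih
  | comp_congr _ _ ih ih' => exact .comp_congr ih ih'
  | reindex_refl p => exact .reindex_refl _
  | reindex_reindex σ τ p => exact .reindex_reindex σ τ _
  | reindex_comp σ p q => exact .reindex_comp σ _ _
  | comp_reindex σ p q => exact .comp_reindex σ _ _
  | unit_comp q => exact .unit_comp _
  | comp_unit p => exact .comp_unit _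
  | assoc p q r =>
    exact .assoc (p.map f g) (fun i => (q i).map f g) (fun i j => (r i j).map f g)
  | left_unit x y =>
    simp only [BVTerm.map, f.onOp_unit]
    exact .left_unit _ _
  | left_reindex σ p y =>
    simp only [BVTerm.map, f.onOp_reindex]
    exact .left_reindex σ _ _
  | left_comp p q y =>
    simp only [BVTerm.map, f.onOp_comp]
    exact .left_comp _ _ _
  | right_unit x y =>
    simp only [BVTerm.map, g.onOp_unit]
    exact .right_unit _ _
  | right_reindex σ x q =>
    simp only [BVTerm.map, g.onOp_reindex]
    exact .right_reindex σ _ _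
  | right_comp x p q =>
    simp only [BVTerm.map, g.onOp_comp]
    exact .right_comp _ _ _
  | interchange p q => exact .interchange (f.onOp p) (g.onOp q)

theorem BVTerm.map_id {P Q : SymOperad} {I : Type} [Finite I]
    {c : I → P.Colour × Q.Colour} {d : P.Colour × Q.Colour} (p : BVTerm P Q c d) :
    p.map (𝟙 P) (𝟙 Q) = p := by
  induction p with
  | left p y => rfl
  | right x q => rfl
  | unit d => rfl
  | reindex σ p ih => exact congrArg (BVTerm.reindex σ) ih
  | comp p q ih ih' => exact congrArg₂ BVTerm.comp ih (funext ih')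

theorem BVTerm.map_comp {P P' P'' Q Q' Q'' : SymOperad} (f : P ⟶ P') (f' : P' ⟶ P'')
    (g : Q ⟶ Q') (g' : Q' ⟶ Q'') {I : Type} [Finite I] {c : I → P.Colour × Q.Colour}
    {d : P.Colour × Q.Colour} (p : BVTerm P Q c d) :
    p.map (f ≫ f') (g ≫ g') = (p.map f g).map f' g' := by
  induction p with
  | left p y => rfl
  | right x q => rfl
  | unit d => rfl
  | reindex σ p ih => exact congrArg (BVTerm.reindex σ) ih
  | comp p q ih ih' => exact congrArg₂ BVTerm.comp ih (funext ih')

/-- The Boardman-Vogt tensor product of two operad maps. -/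
noncomputable def bvTensorMap {P P' Q Q' : SymOperad} (f : P ⟶ P') (g : Q ⟶ Q') :
    bvTensor P Q ⟶ bvTensor P' Q' where
  colour c := (f.colour c.1, g.colour c.2)
  onOp := Quotient.map (BVTerm.map f g) (fun _ _ h => BVTerm.map_rel f g h)
  onOp_unit _ := rfl
  onOp_reindex σ _ _ p := by
    induction p using Quotient.inductionOn
    rfl
  onOp_comp p q := by
    induction p using Quotient.inductionOn with | h p => _
    obtain ⟨q, rfl⟩ := bv_exists_rep q
    exact (congrArg (Quotient.map (BVTerm.map f g) (fun _ _ h => BVTerm.map_rel f g h))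
      (bvComp_mk (P := P) (Q := Q) p q)).trans
      (bvComp_mk (p.map f g) (fun i => (q i).map f g)).symm

theorem bvTensorMap_id (P Q : SymOperad) : bvTensorMap (𝟙 P) (𝟙 Q) = 𝟙 (bvTensor P Q) := by
  refine SymOperad.Hom.ext rfl (heq_of_eq ?_)
  funext I _ c d p
  induction p using Quotient.inductionOn with
  | h p => exact congrArg (Quotient.mk _) (BVTerm.map_id p)

theorem bvTensorMap_comp {P P' P'' Q Q' Q'' : SymOperad} (f : P ⟶ P') (f' : P' ⟶ P'')
    (g : Q ⟶ Q') (g' : Q' ⟶ Q'') :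
    bvTensorMap (f ≫ f') (g ≫ g') = bvTensorMap f g ≫ bvTensorMap f' g' := by
  refine SymOperad.Hom.ext rfl (heq_of_eq ?_)
  funext I _ c d p
  induction p using Quotient.inductionOn with
  | h p => exact congrArg (Quotient.mk _) (BVTerm.map_comp f f' g g' p)

/-! ### Trees and the category `Ω` -/

/-- A finite rooted tree, possibly with leaves (edges which are not the output of a vertex) and
with nullary vertices. Every vertex has an output edge, different vertices having different
outputs; `below e` is the vertex of which `e` is an input, and does not exist precisely when `e`
is the root edge. Going down repeatedly from any edge, one arrives at the root. -/
structure Tree where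
  Edge : Type
  Vertex : Type
  finite_edge : Finite Edge
  finite_vertex : Finite Vertex
  root : Edge
  out : Vertex → Edge
  out_injective : Function.Injective out
  below : Edge → Option Vertex
  below_eq_none_iff (e : Edge) : below e = none ↔ e = root
  reaches_root (e : Edge) :
    Relation.ReflTransGen (fun e e' => ∃ v, below e = some v ∧ out v = e') e root

attribute [instance] Tree.finite_edge Tree.finite_vertex

/-- The set of input edges of a vertex. -/
abbrev Tree.Input (T : Tree) (v : T.Vertex) : Type := {e : T.Edge // T.below e = some v}

/-- A tree is open if it has no nullary vertices. -/
def Tree.IsOpen (T : Tree) : Prop := ∀ v : T.Vertex, Nonempty (T.Input v)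

/-- `T.HasSubtree c d` says that the edges `c i` are, without repetition, the leaves of a subtree
of `T` with root edge `d`. Such a subtree is either a single edge, or consists of a vertex `v` with
output edge `d` and subtrees grafted onto all the inputs of `v`. -/
inductive Tree.HasSubtree (T : Tree) : {I : Type} → (I → T.Edge) → T.Edge → Prop
  | edge (e : T.Edge) : HasSubtree T (fun _ : Unit => e) e
  | graft (v : T.Vertex) {J : T.Input v → Type} {b : ∀ i, J i → T.Edge}
      (h : ∀ i, HasSubtree T (b i) i.1) :
      HasSubtree T (fun x : Σ i, J i => b x.1 x.2) (T.out v)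
  | reindex {I J : Type} (σ : I ≃ J) {c : J → T.Edge} {d : T.Edge}
      (h : HasSubtree T (fun i => c (σ i)) d) : HasSubtree T c d

theorem Tree.HasSubtree.comp {T : Tree} {I : Type} {c : I → T.Edge} {d : T.Edge}
    (h : T.HasSubtree c d) : ∀ {J : I → Type} {b : ∀ i, J i → T.Edge},
      (∀ i, T.HasSubtree (b i) (c i)) → T.HasSubtree (fun x : Σ i, J i => b x.1 x.2) d := by
  induction h with
  | edge e =>
    intro J b hb
    exact .reindex (Equiv.uniqueSigma J).symm (hb ())
  | graft v _ ih =>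
    intro J b hb
    refine .reindex (Equiv.sigmaAssoc (fun i j => J ⟨i, j⟩)).symm ?_
    exact .graft v (fun i => ih i (fun j => hb ⟨i, j⟩))
  | reindex σ _ ih =>
    intro J b hb
    exact .reindex (Equiv.sigmaCongrLeft (β := J) σ) (ih (fun i => hb (σ i)))

/-- The free operad `Ω(T)` on a tree `T`: its colours are the edges of `T`, and there is exactly
one operation from the leaves of each subtree to its root edge, and no other operation. -/
def Tree.operad (T : Tree) : SymOperad where
  Colour := T.Edge
  Op := fun c d => ULift (PLift (T.HasSubtree c d))
  unit d := ⟨⟨.edge d⟩⟩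
  reindex σ _ _ p := ⟨⟨.reindex σ p.down.down⟩⟩
  comp p q := ⟨⟨p.down.down.comp (fun i => (q i).down.down)⟩⟩
  reindex_refl _ := rfl
  reindex_reindex _ _ _ _ _ := rfl
  reindex_comp _ _ _ _ _ _ _ _ := rfl
  comp_reindex _ _ _ _ _ _ := rfl
  unit_comp _ := rfl
  comp_unit _ := rfl
  assoc _ _ _ := rfl

/-- The category `Ω` of trees: morphisms `S ⟶ T` are the operad maps from `Ω(S)` to `Ω(T)`. -/
instance : Category Tree where
  Hom S T := SymOperad.Hom S.operad T.operad
  id T := 𝟙 T.operad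
  comp f g := CategoryStruct.comp (obj := SymOperad) f g

/-- The inclusion of `Ω` into the category of operads. -/
def treeOperad : Tree ⥤ SymOperad where
  obj T := T.operad
  map f := f

/-! ### Dendroidal sets -/

/-- Dendroidal sets are presheaves of sets on `Ω`. -/
abbrev DSet := Treeᵒᵖ ⥤ Type 1

/-- The representable dendroidal set `Ω[T]`. -/
abbrev representable (T : Tree) : DSet := yoneda.obj T

/-- A morphism `i : F ⟶ T` of `Ω` is (the inclusion of) a proper face if it is injective on edges
and not an isomorphism; up to isomorphism, these are exactly the nonempty composites of inner face,
top face and root face inclusions and of inclusions of an edge into a corolla. -/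
def IsProperFace {F T : Tree} (i : F ⟶ T) : Prop :=
  Function.Injective (SymOperad.Hom.colour i) ∧ ¬ IsIso i

/-- The boundary `∂Ω[T]`, the union in `Ω[T]` of all the proper faces of `T`. -/
def boundary (T : Tree) : Subfunctor (representable T) where
  obj R := {f | ∃ (F : Tree) (i : F ⟶ T) (g : R.unop ⟶ F), IsProperFace i ∧ g ≫ i = f}
  map := by
    rintro R R' h _ ⟨F, i, g, hi, rfl⟩
    exact ⟨F, i, h.unop ≫ g, hi, Category.assoc _ _ _⟩

/-! ### The tensor product of dendroidal sets -/

/-- Representatives of the elements of `(X ⊗ Y)(R)`: elements `x` of `X(S)` and `y` of `Y(T)`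
together with a dendrex of shape `R` of the nerve of `Ω(S) ⊗ Ω(T)`. -/
structure TensorPre (X Y : DSet) (R : Tree) where
  S : Tree
  T : Tree
  x : X.obj (.op S)
  y : Y.obj (.op T)
  f : treeOperad.obj R ⟶ bvTensor (treeOperad.obj S) (treeOperad.obj T)

/-- The relation defining the coend over `S` and `T`. -/
inductive TensorRel (X Y : DSet) (R : Tree) : TensorPre X Y R → TensorPre X Y R → Prop
  | mk {S S' T T' : Tree} (s : S ⟶ S') (t : T ⟶ T') (x : X.obj (.op S')) (y : Y.obj (.op T'))
      (f : treeOperad.obj R ⟶ bvTensor (treeOperad.obj S) (treeOperad.obj T)) :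
      TensorRel X Y R ⟨S, T, X.map s.op x, Y.map t.op y, f⟩
        ⟨S', T', x, y, f ≫ bvTensorMap (treeOperad.map s) (treeOperad.map t)⟩

/-- The tensor product `X ⊗ Y` of dendroidal sets: the coend of
`X(S) × Y(T) × N_d(Ω(S) ⊗ Ω(T))` over `S` and `T` in `Ω`, where `N_d` is the dendroidal nerve. It
is the extension, preserving colimits in both variables, of
`Ω[S] ⊗ Ω[T] = N_d(Ω(S) ⊗ Ω(T))`. -/
noncomputable def tensorObj (X Y : DSet) : DSet where
  obj R := Quot (TensorRel X Y R.unop)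
  map {R R'} h := TypeCat.ofHom (Quot.map
    (fun z => ⟨z.S, z.T, z.x, z.y, treeOperad.map h.unop ≫ z.f⟩)
    (by
      rintro _ _ ⟨s, t, x, y, f⟩
      exact .mk s t x y (treeOperad.map h.unop ≫ f)))
  map_id R := by
    ext z
    induction z using Quot.inductionOn
    rfl
  map_comp h h' := by
    ext z
    induction z using Quot.inductionOn
    rfl

/-- The map `X ⊗ Y ⟶ X' ⊗ Y'` induced by `φ : X ⟶ X'` and `ψ : Y ⟶ Y'`. -/
noncomputable def tensorMap {X X' Y Y' : DSet} (φ : X ⟶ X') (ψ : Y ⟶ Y') : tensorObj X Y ⟶ tensorObj X' Y' where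
  app R := TypeCat.ofHom (Quot.map
    (fun z => ⟨z.S, z.T, φ.app _ z.x, ψ.app _ z.y, z.f⟩)
    (by
      rintro _ _ ⟨s, t, x, y, f⟩
      have := TensorRel.mk (R := R.unop) s t (φ.app _ x) (ψ.app _ y) f
      simpa only [NatTrans.naturality_apply] using this))
  naturality R R' h := by
    ext z
    induction z using Quot.inductionOn
    rfl

/-- The tensor product as a functor of two variables. -/
noncomputable def tensor : DSet ⥤ DSet ⥤ DSet where
  obj X :=
    { obj := fun Y => tensorObj X Y
      map := fun ψ => tensorMap (𝟙 X) ψ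
      map_id := fun Y => by
        ext R z
        induction z using Quot.inductionOn
        rfl
      map_comp := fun ψ ψ' => by
        ext R z
        induction z using Quot.inductionOn
        rfl }
  map φ :=
    { app := fun Y => tensorMap φ (𝟙 Y)
      naturality := fun Y Y' ψ => by
        ext R z
        induction z using Quot.inductionOn
        rfl }
  map_id X := by
    ext Y R z
    induction z using Quot.inductionOn
    rfl
  map_comp φ φ' := by
    ext Y R z
    induction z using Quot.inductionOn
    rfl

/-- The map `X ⊗ B ∪_{A ⊗ B} A ⊗ Y ⟶ X ⊗ Y` out of the pushout, for `φ : A ⟶ X` and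
`ψ : B ⟶ Y`. -/
noncomputable def pushoutProduct {A X B Y : DSet} (φ : A ⟶ X) (ψ : B ⟶ Y) :
    Limits.pushout ((tensor.map φ).app B) ((tensor.obj A).map ψ) ⟶ (tensor.obj X).obj Y :=
  Limits.pushout.desc ((tensor.obj X).map ψ) ((tensor.map φ).app Y) (by simp)

/-! ### Normality -/

/-- A dendroidal set `X` is normal if `Aut(R)` acts freely on `X(R)` for every tree `R`. -/
def IsNormal (X : DSet) : Prop :=
  ∀ (R : Tree) (x : X.obj (.op R)) (σ : R ≅ R), X.map σ.hom.op x = x → σ = Iso.refl R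

/-- A map `φ : X ⟶ Y` of dendroidal sets is a normal monomorphism if it is a monomorphism and
`Aut(R)` acts freely on the complement of the image of `X(R)` in `Y(R)` for every tree `R`. -/
def IsNormalMono {X Y : DSet} (φ : X ⟶ Y) : Prop :=
  Mono φ ∧ ∀ (R : Tree) (y : Y.obj (.op R)), y ∉ Set.range (φ.app (.op R)) →
    ∀ σ : R ≅ R, Y.map σ.hom.op y = y → σ = Iso.refl R

end Dendroidal

/-!
The edges of an open tree form a finite poset with the root as least element, in which the elements
below any given one form a chain. In such a poset, and in a product of two of them, there is a
notion of a cut above an element `d`: a family of elements above `d` without common upper bounds,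
such that everything above `d` has a common upper bound with a member of the family.

For an open tree `T`, the operations of `Ω(T)` are exactly the cuts (`Tree.HasSubtree.isCut`,
`IsCut.hasSubtree`). The main point is that the same holds for `Ω(S) ⊗ Ω(T)` and the poset
`S.Edge × T.Edge`, when `S` and `T` are open (`isCut_of_op`, `op_eq`, `IsCut.nonempty_op`). An
operation is determined by its inputs and output because of the interchange relation: if the
`S`-colours of all inputs lie strictly above that of the output, then a vertex of `S` can be moved
to the root (`leftRoot_of_lt`); otherwise the root is necessarily a vertex of `T`, unless the
operation is a unit. In both cases the operations grafted onto the root are determined by induction.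
Moving a vertex of `S` below a vertex `w` of `T` requires `w` to have inputs, which is where
openness is needed.

Hence a map `f : Ω(R) ⟶ Ω(S) ⊗ Ω(T)` is a map from the edges of `R` to `S.Edge × T.Edge` which
preserves cuts. Normality follows: an automorphism of `R` over `f` is an automorphism of the poset
of edges, and `f` separates the inputs of a vertex (`edgeMap_eq_self`).

For the pushout, the edges of `S` occurring in `f` are the edges of a face of `S`, and similarly for
`T` (`isFacial_range_fst`, `isFacial_range_snd`). As cuts restrict to subposets, `f` factors through
the tensor product of these two faces, and through any tensor product of faces containing them. So
every dendrex of `A ⊗ B`, for `A` the boundary of `Ω[S]` or `Ω[S]` itself and `B` similarly, is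
represented by this canonical factorization of its image in `Ω[S] ⊗ Ω[T]`
(`mk_eq_of_isSupported`). This shows that `A ⊗ B ⟶ Ω[S] ⊗ Ω[T]` is injective and that the
intersection of the images of `∂Ω[S] ⊗ Ω[T]` and `Ω[S] ⊗ ∂Ω[T]` is that of `∂Ω[S] ⊗ ∂Ω[T]`.
-/

namespace Dendroidal

/-! ### Cuts in preorders -/

/-- Two elements of a preorder are compatible if they have a common upper bound. In the poset of
edges of a tree, this means that they are comparable. -/
def Compat {P : Type*} [Preorder P] (a b : P) : Prop := ∃ q, a ≤ q ∧ b ≤ q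

theorem Compat.symm {P : Type*} [Preorder P] {a b : P} : Compat a b → Compat b a :=
  fun ⟨q, h, h'⟩ => ⟨q, h', h⟩

theorem Compat.of_le {P : Type*} [Preorder P] {a b : P} (h : a ≤ b) : Compat a b :=
  ⟨b, h, le_rfl⟩

theorem Compat.mono {P : Type*} [Preorder P] {a a' b b' : P} (h : Compat a b) (ha : a' ≤ a)
    (hb : b' ≤ b) : Compat a' b' :=
  let ⟨q, h, h'⟩ := h
  ⟨q, ha.trans h, hb.trans h'⟩

/-- A cut above `d` is a family of pairwise incompatible elements above `d` such that every element
above `d` is compatible with a member of the family. Operations of the operads `Ω(T)` and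
`Ω(S) ⊗ Ω(T)`, for open trees, turn out to be the same as cuts. -/
structure IsCut {P : Type*} [Preorder P] {I : Type*} (c : I → P) (d : P) : Prop where
  le (i : I) : d ≤ c i
  eq_of_compat {i j : I} : Compat (c i) (c j) → i = j
  exists_compat {p : P} : d ≤ p → ∃ i, Compat p (c i)

section Cut

variable {P : Type*} [Preorder P]

theorem isCut_unit (d : P) : IsCut (fun _ : Unit => d) d :=
  ⟨fun _ => le_rfl, fun _ => rfl, fun h => ⟨(), (Compat.of_le h).symm⟩⟩

theorem IsCut.reindex {I J : Type*} (σ : I ≃ J) {c : J → P} {d : P}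
    (h : IsCut (fun i => c (σ i)) d) : IsCut c d where
  le j := by simpa using h.le (σ.symm j)
  eq_of_compat {i j} hij := σ.symm.injective (h.eq_of_compat (by simpa using hij))
  exists_compat hp := let ⟨i, hi⟩ := h.exists_compat hp; ⟨σ i, hi⟩

theorem IsCut.comp {I : Type*} {J : I → Type*} {b : ∀ i, J i → P} {c : I → P} {d : P}
    (h : IsCut c d) (h' : ∀ i, IsCut (b i) (c i)) :
    IsCut (fun x : Σ i, J i => b x.1 x.2) d where
  le x := (h.le x.1).trans ((h' x.1).le x.2)
  eq_of_compat {x y} hxy := by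
    obtain ⟨i, j⟩ := x
    obtain ⟨i', j'⟩ := y
    obtain rfl : i = i' := h.eq_of_compat (hxy.mono ((h' i).le j) ((h' i').le j'))
    obtain rfl : j = j' := (h' i).eq_of_compat hxy
    rfl
  exists_compat {p} hp := by
    obtain ⟨i, q, hpq, hiq⟩ := h.exists_compat hp
    obtain ⟨j, hj⟩ := (h' i).exists_compat hiq
    exact ⟨⟨i, j⟩, hj.mono hpq le_rfl⟩

theorem IsCut.nonempty {I : Type*} {c : I → P} {d : P} (h : IsCut c d) : Nonempty I :=
  let ⟨i, _⟩ := h.exists_compat le_rfl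
  ⟨i⟩

theorem IsCut.subsingleton_of_eq {I : Type*} {c : I → P} {d : P} (h : IsCut c d) {i : I}
    (hi : c i = d) : Subsingleton I :=
  have key (j : I) : i = j := h.eq_of_compat (.of_le (hi ▸ h.le j))
  ⟨fun j k => (key j).symm.trans (key k)⟩

/-- If a cut `c` above `d` refines a cut `c₀` above `d`, then the members of `c` above a given
member of `c₀` are a cut above it. -/
theorem IsCut.restrict {A I : Type*} {c₀ : A → P} {c : I → P} {d : P} (h : IsCut c d)
    (h₀ : IsCut c₀ d) (hle : ∀ i, ∃ a, c₀ a ≤ c i) (a : A) :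
    IsCut (fun j : {i // c₀ a ≤ c i} => c j) (c₀ a) where
  le j := j.2
  eq_of_compat hij := Subtype.ext (h.eq_of_compat hij)
  exists_compat {p} hp := by
    obtain ⟨i, q, hpq, hiq⟩ := h.exists_compat ((h₀.le a).trans hp)
    obtain ⟨a', ha'⟩ := hle i
    obtain rfl : a = a' := h₀.eq_of_compat ⟨q, hp.trans hpq, ha'.trans hiq⟩
    exact ⟨⟨i, ha'⟩, q, hpq, hiq⟩

/-- The members of a family refining the cut `c₀`, sorted by the members of `c₀` below them. -/
noncomputable def IsCut.refineEquiv {A I : Type*} {c₀ : A → P} {d : P} (h₀ : IsCut c₀ d)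
    (c : I → P) (hle : ∀ i, ∃ a, c₀ a ≤ c i) : (Σ a, {i // c₀ a ≤ c i}) ≃ I :=
  Equiv.ofBijective (fun x => x.2.1) <| by
    refine ⟨?_, fun i => let ⟨a, ha⟩ := hle i; ⟨⟨a, i, ha⟩, rfl⟩⟩
    rintro ⟨a, i, hi⟩ ⟨a', i', hi'⟩ (rfl : i = i')
    obtain rfl : a = a' := h₀.eq_of_compat ⟨_, hi, hi'⟩
    rfl

theorem Compat.prod {Q : Type*} [Preorder Q] {x y : P × Q} (h : Compat x.1 y.1)
    (h' : Compat x.2 y.2) : Compat x y :=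
  let ⟨p, hp, hp'⟩ := h
  let ⟨q, hq, hq'⟩ := h'
  ⟨(p, q), ⟨hp, hq⟩, ⟨hp', hq'⟩⟩

theorem Compat.fst {Q : Type*} [Preorder Q] {x y : P × Q} (h : Compat x y) : Compat x.1 y.1 :=
  let ⟨q, h, h'⟩ := h
  ⟨q.1, h.1, h'.1⟩

theorem Compat.snd {Q : Type*} [Preorder Q] {x y : P × Q} (h : Compat x y) : Compat x.2 y.2 :=
  let ⟨q, h, h'⟩ := h
  ⟨q.2, h.2, h'.2⟩

theorem IsCut.prodLeft {Q : Type*} [Preorder Q] {I : Type*} {c : I → P} {d : P} (h : IsCut c d)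
    (y : Q) : IsCut (fun i => (c i, y)) (d, y) where
  le i := ⟨h.le i, le_rfl⟩
  eq_of_compat hij := h.eq_of_compat hij.fst
  exists_compat hp :=
    let ⟨i, hi⟩ := h.exists_compat hp.1
    ⟨i, hi.prod (Compat.of_le hp.2).symm⟩

theorem IsCut.prodRight {Q : Type*} [Preorder Q] {I : Type*} {c : I → Q} {d : Q} (h : IsCut c d)
    (x : P) : IsCut (fun i => (x, c i)) (x, d) where
  le i := ⟨le_rfl, h.le i⟩
  eq_of_compat hij := h.eq_of_compat hij.snd
  exists_compat hp :=
    let ⟨i, hi⟩ := h.exists_compat hp.2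
    ⟨i, Compat.prod (Compat.of_le hp.1).symm hi⟩

end Cut

/-! ### The poset of edges of a tree -/

section TreeOrder

variable {T : Tree}

/-- `T.Step e e'` says that `e` is an input of a vertex with output `e'`. -/
def Tree.Step (T : Tree) (e e' : T.Edge) : Prop := ∃ v, T.below e = some v ∧ T.out v = e'

theorem Tree.Step.unique {a b b' : T.Edge} : T.Step a b → T.Step a b' → b = b' := by
  rintro ⟨v, h, rfl⟩ ⟨v', h', rfl⟩
  rw [Option.some.inj (h.symm.trans h')]

theorem Tree.not_transGen_step (e : T.Edge) : ¬ Relation.TransGen T.Step e e := by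
  induction T.reaches_root e using Relation.ReflTransGen.head_induction_on with
  | refl =>
    intro h
    obtain ⟨e, ⟨v, hv, -⟩, -⟩ := Relation.TransGen.head'_iff.1 h
    rw [(T.below_eq_none_iff T.root).2 rfl] at hv
    cases hv
  | head h _ ih =>
    intro h'
    obtain ⟨e, he, he'⟩ := Relation.TransGen.head'_iff.1 h'
    cases Tree.Step.unique he h
    exact ih (Relation.TransGen.tail' he' he)

/-- The edges of a tree are partially ordered, `e ≤ e'` meaning that `e` lies on the path from `e'`
to the root. -/
instance : PartialOrder T.Edge where
  le e e' := Relation.ReflTransGen T.Step e' e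
  le_refl _ := .refl
  le_trans _ _ _ h h' := h'.trans h
  le_antisymm a b h h' := by
    rcases Relation.reflTransGen_iff_eq_or_transGen.1 h with rfl | h
    · rfl
    · exact (T.not_transGen_step _ (h.trans_left h')).elim

/-- The root is the least edge. -/
instance : OrderBot T.Edge where
  bot := T.root
  bot_le := T.reaches_root

theorem Tree.le_def {e e' : T.Edge} : e ≤ e' ↔ Relation.ReflTransGen T.Step e' e := Iff.rfl

theorem Tree.le_total_of_le {a b c : T.Edge} (ha : a ≤ c) (hb : b ≤ c) : a ≤ b ∨ b ≤ a := by
  refine (Relation.ReflTransGen.total_of_right_unique ?_ ha hb).symm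
  exact fun _ _ _ => Tree.Step.unique

theorem Tree.compat_iff {a b : T.Edge} : Compat a b ↔ a ≤ b ∨ b ≤ a :=
  ⟨fun ⟨_, h, h'⟩ => T.le_total_of_le h h', fun h => h.elim .of_le fun h => (Compat.of_le h).symm⟩

theorem Tree.out_lt {v : T.Vertex} (a : T.Input v) : T.out v < a.1 := by
  refine lt_of_le_of_ne (.single ⟨v, a.2, rfl⟩) fun h => ?_
  exact T.not_transGen_step a.1 (.single ⟨v, a.2, h⟩)

theorem Tree.exists_vertex_of_lt {d e : T.Edge} (h : d < e) :
    ∃ v, T.out v = d ∧ ∃ a : T.Input v, a.1 ≤ e := by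
  rcases Relation.reflTransGen_iff_eq_or_transGen.1 (Tree.le_def.1 h.le) with rfl | h'
  · exact (lt_irrefl _ h).elim
  · obtain ⟨a, ha, v, hv, hd⟩ := Relation.TransGen.tail'_iff.1 h'
    exact ⟨v, hd, ⟨a, hv⟩, ha⟩

theorem Tree.exists_input_le {v : T.Vertex} {e : T.Edge} (h : T.out v < e) :
    ∃ a : T.Input v, a.1 ≤ e := by
  obtain ⟨v', hv, h⟩ := T.exists_vertex_of_lt h
  rwa [T.out_injective hv] at h

theorem Tree.input_eq {v : T.Vertex} {a a' : T.Input v} (h : a.1 ≤ a'.1) : a = a' := by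
  refine Subtype.ext (h.eq_or_lt.resolve_right fun h' => ?_)
  obtain ⟨b, ⟨w, hw, rfl⟩, hb⟩ :=
    Relation.TransGen.head'_iff.1
      ((Relation.reflTransGen_iff_eq_or_transGen.1 h).resolve_left h'.ne)
  obtain rfl : v = w := Option.some.inj (a'.2.symm.trans hw)
  exact (T.out_lt a).not_ge hb

theorem Tree.isCut_input {v : T.Vertex} (hv : Nonempty (T.Input v)) :
    IsCut (fun a : T.Input v => a.1) (T.out v) where
  le a := (T.out_lt a).le
  eq_of_compat h := (T.compat_iff.1 h).elim T.input_eq fun h => (T.input_eq h).symm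
  exists_compat {p} hp := by
    rcases hp.eq_or_lt with rfl | hp
    · exact hv.elim fun a => ⟨a, .of_le (T.out_lt a).le⟩
    · obtain ⟨a, ha⟩ := T.exists_input_le hp
      exact ⟨a, (Compat.of_le ha).symm⟩

theorem Tree.HasSubtree.isCut (hT : T.IsOpen) {I : Type} {c : I → T.Edge} {d : T.Edge}
    (h : T.HasSubtree c d) : IsCut c d := by
  induction h with
  | edge e => exact isCut_unit e
  | graft v _ ih => exact (T.isCut_input (hT v)).comp ih
  | reindex σ _ ih => exact ih.reindex σ

theorem IsCut.hasSubtree (hT : T.IsOpen) {d : T.Edge} {I : Type} {c : I → T.Edge}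
    (h : IsCut c d) : T.HasSubtree c d := by
  induction d using WellFoundedGT.induction generalizing I with
  | ind d ih =>
    by_cases hd : ∃ i, c i = d
    · obtain ⟨i, hi⟩ := hd
      have := h.subsingleton_of_eq hi
      let σ : Unit ≃ I := ⟨fun _ => i, fun _ => (), fun _ => rfl, fun _ => Subsingleton.elim _ _⟩
      exact .reindex σ (by simpa [σ, hi] using Tree.HasSubtree.edge d)
    · have hlt (i) : d < c i := lt_of_le_of_ne (h.le i) fun hi => hd ⟨i, hi.symm⟩
      obtain ⟨i⟩ := h.nonempty
      obtain ⟨v, rfl, -⟩ := T.exists_vertex_of_lt (hlt i)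
      have hle (i) := T.exists_input_le (hlt i)
      have hv := T.isCut_input (hT v)
      exact .reindex (hv.refineEquiv c hle)
        (.graft v fun a => ih _ (T.out_lt a) (h.restrict hv hle a))

/-- The leaves which are not above the antichain `A` form, together with `A`, a cut above the
root. -/
theorem Tree.isCut_of_antichain (T : Tree) {A : Set T.Edge}
    (hA : ∀ a ∈ A, ∀ b ∈ A, a ≤ b → a = b) :
    IsCut (fun x : {e // e ∈ A ∨ IsMax e ∧ ∀ a ∈ A, ¬ a ≤ e} => x.1) ⊥ where
  le _ := bot_le
  eq_of_compat {x y} h := by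
    have key {x y : {e // e ∈ A ∨ IsMax e ∧ ∀ a ∈ A, ¬ a ≤ e}} (hxy : x.1 ≤ y.1) : x = y := by
      obtain ⟨x, hx⟩ := x
      obtain ⟨y, hy⟩ := y
      refine Subtype.ext ?_
      rcases hx with hx | ⟨hx, _⟩
      · exact hy.elim (fun hy => hA x hx y hy hxy) fun hy => (hy.2 x hx hxy).elim
      · exact hx.eq_of_le hxy
    exact (T.compat_iff.1 h).elim key fun h => (key h).symm
  exists_compat {p} _ := by
    obtain ⟨m, hpm, hm⟩ := Finite.exists_le_maximal (p := fun _ : T.Edge => True) (a := p) trivial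
    rw [maximal_true] at hm
    by_cases h : ∃ a ∈ A, a ≤ m
    · obtain ⟨a, ha, ham⟩ := h
      exact ⟨⟨a, .inl ha⟩, m, hpm, ham⟩
    · push Not at h
      exact ⟨⟨m, .inr ⟨hm, h⟩⟩, .of_le hpm⟩

end TreeOrder

/-! ### Operations with a given root operation -/

namespace SymOperad

variable {O : SymOperad}

theorem reindex_eq_of_eq {I J : Type} [Finite I] [Finite J] {σ σ' : I ≃ J} (h : σ = σ')
    {c : J → O.Colour} {d : O.Colour} {x : O.Op (fun i => c (σ i)) d}
    {x' : O.Op (fun i => c (σ' i)) d} (hx : HEq x x') : O.reindex σ x = O.reindex σ' x' := by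
  subst h
  rw [eq_of_heq hx]

theorem comp_comp {I : Type} [Finite I] {J : I → Type} [∀ i, Finite (J i)]
    {K : (Σ i, J i) → Type} [∀ x, Finite (K x)] {a : ∀ x, K x → O.Colour}
    {b : ∀ i, J i → O.Colour} {c : I → O.Colour} {d : O.Colour} (p : O.Op c d)
    (q : ∀ i, O.Op (b i) (c i)) (r : ∀ x : Σ i, J i, O.Op (a x) (b x.1 x.2)) :
    O.comp (O.comp p q) r =
      O.reindex (c := fun y : Σ x, K x => a y.1 y.2) (Equiv.sigmaAssoc fun i j => K ⟨i, j⟩).symm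
        (O.comp p fun i => O.comp (q i) fun j => r ⟨i, j⟩) := by
  rw [← O.assoc p q fun i j => r ⟨i, j⟩]
  refine .trans ?_ (O.reindex_reindex (Equiv.sigmaAssoc fun i j => K ⟨i, j⟩)
    (Equiv.sigmaAssoc fun i j => K ⟨i, j⟩).symm (c := fun y : Σ x, K x => a y.1 y.2)
      (O.comp (O.comp p q) r)).symm
  exact (O.reindex_refl _).symm

/-- `HasRoot p x` says that the operation `x` is obtained by grafting operations onto the inputs
of `p`, up to reordering. -/
def HasRoot {A : Type} [Finite A] {c₀ : A → O.Colour} {d : O.Colour} (p : O.Op c₀ d) {I : Type}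
    [Finite I] {c : I → O.Colour} (x : O.Op c d) : Prop :=
  ∃ (J : A → Type) (_ : ∀ a, Finite (J a)) (σ : (Σ a, J a) ≃ I)
    (q : ∀ a, O.Op (fun j => c (σ ⟨a, j⟩)) (c₀ a)), x = O.reindex σ (O.comp p q)

section HasRoot

variable {A : Type} [Finite A] {c₀ : A → O.Colour} {d : O.Colour} {p : O.Op c₀ d}

theorem HasRoot.of_comp {J : A → Type} [∀ a, Finite (J a)] {b : ∀ a, J a → O.Colour}
    (q : ∀ a, O.Op (b a) (c₀ a)) : HasRoot p (O.comp p q) :=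
  ⟨J, inferInstance, Equiv.refl _, q, (O.reindex_refl _).symm⟩

theorem HasRoot.reindex {I J : Type} [Finite I] [Finite J] (σ : I ≃ J) {c : J → O.Colour}
    {x : O.Op (fun i => c (σ i)) d} (h : HasRoot p x) : HasRoot p (O.reindex σ x) := by
  obtain ⟨K, hK, τ, q, rfl⟩ := h
  exact ⟨K, hK, τ.trans σ, q, O.reindex_reindex τ σ _⟩

theorem HasRoot.comp {I : Type} [Finite I] {c : I → O.Colour} {x : O.Op c d} (h : HasRoot p x)
    {J : I → Type} [∀ i, Finite (J i)] {b : ∀ i, J i → O.Colour} (y : ∀ i, O.Op (b i) (c i)) :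
    HasRoot p (O.comp x y) := by
  obtain ⟨K, hK, τ, q, rfl⟩ := h
  rw [O.reindex_comp, comp_comp]
  exact .reindex _ (.reindex _ (.of_comp _))

/-- If the composite of `B` with operations `W'` has root `W`, as is the case when `B` and `W`
interchange, and all the operations grafted onto `B` have root `W'`, then `W` can be moved to the
root. -/
theorem HasRoot.of_interchange {L : Type} [Finite L] {d' : L → O.Colour} {c' : L → A → O.Colour}
    {W : O.Op c₀ d} {W' : ∀ l, O.Op (c' l) (d' l)} {B : O.Op d' d}
    (h : HasRoot W (O.comp B W')) {J : L → Type} [∀ l, Finite (J l)] {b : ∀ l, J l → O.Colour}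
    (q : ∀ l, O.Op (b l) (d' l)) (hq : ∀ l, HasRoot (W' l) (q l)) :
    HasRoot W (O.comp B q) := by
  choose K hK τ r hr using hq
  rw [show q = _ from funext hr, O.comp_reindex τ, ← O.assoc]
  exact .reindex _ (.reindex _ (h.comp _))

end HasRoot

/-- If all the operations are cuts, the inputs of an operation with root `p` are distributed
over the inputs of `p` according to the order. -/
theorem HasRoot.exists_eq [Preorder O.Colour]
    (hO : ∀ {I : Type} [Finite I] {c : I → O.Colour} {d : O.Colour}, O.Op c d → IsCut c d)
    {A : Type} [Finite A] {c₀ : A → O.Colour} {d : O.Colour} {p : O.Op c₀ d} {I : Type}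
    [Finite I] {c : I → O.Colour} {x : O.Op c d} (h : HasRoot p x) :
    ∃ (hle : ∀ i, ∃ a, c₀ a ≤ c i) (q : ∀ a, O.Op (fun j : {i // c₀ a ≤ c i} => c j) (c₀ a)),
      x = O.reindex ((hO p).refineEquiv c hle) (O.comp p q) := by
  obtain ⟨J, hJ, σ, q, rfl⟩ := h
  have hle (i) : c₀ (σ.symm i).1 ≤ c i := by
    obtain ⟨x, rfl⟩ := σ.surjective i
    simpa using (hO (q x.1)).le x.2
  let τ (a) : J a ≃ {i // c₀ a ≤ c i} :=
    Equiv.ofBijective (fun j => ⟨σ ⟨a, j⟩, (hO (q a)).le j⟩) <| by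
      refine ⟨fun j j' hj => ?_, fun i => ?_⟩
      · simpa using congrArg Subtype.val hj
      · obtain ⟨i, hi⟩ := i
        obtain ⟨⟨a', j⟩, rfl⟩ := σ.surjective i
        obtain rfl : a = a' := (hO p).eq_of_compat ⟨_, hi, (hO (q a')).le j⟩
        exact ⟨j, rfl⟩
  refine ⟨fun i => ⟨_, hle i⟩, fun a => O.reindex (τ a) (q a), ?_⟩
  refine .trans ?_ (congrArg (O.reindex ((hO p).refineEquiv c fun i => ⟨_, hle i⟩))
    (O.comp_reindex τ (b := fun a (i : {i // c₀ a ≤ c i}) => c i) p q)).symm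
  refine .trans ?_ (O.reindex_reindex (Equiv.sigmaCongrRight τ)
    ((hO p).refineEquiv c fun i => ⟨_, hle i⟩) (O.comp p q)).symm
  have hσ : σ = (Equiv.sigmaCongrRight τ).trans ((hO p).refineEquiv c fun i => ⟨_, hle i⟩) :=
    Equiv.ext fun _ => rfl
  exact reindex_eq_of_eq (c := c) (x := O.comp p q) (x' := O.comp p q) hσ HEq.rfl

/-- The operations obtained from units by repeatedly grafting operations onto the inputs of an
operation in the class `G`, and relabelling. -/
inductive Generated (O : SymOperad) (G : ∀ {A : Type} [Finite A] {c₀ : A → O.Colour}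
    {d : O.Colour}, O.Op c₀ d → Prop) : {I : Type} → [Finite I] → {c : I → O.Colour} →
    {d : O.Colour} → O.Op c d → Prop
  | unit (d : O.Colour) : Generated O G (O.unit d)
  | graft {A : Type} [Finite A] {c₀ : A → O.Colour} {d : O.Colour} (p : O.Op c₀ d) (hp : G p)
      {J : A → Type} [∀ a, Finite (J a)] {b : ∀ a, J a → O.Colour}
      (q : ∀ a, O.Op (b a) (c₀ a)) :
      (∀ a, Generated O G (q a)) → Generated O G (O.comp p q)
  | reindex {I J : Type} [Finite I] [Finite J] (σ : I ≃ J) {c : J → O.Colour} {d : O.Colour}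
      (x : O.Op (fun i => c (σ i)) d) : Generated O G x → Generated O G (O.reindex σ x)

theorem Generated.comp {G : ∀ {A : Type} [Finite A] {c₀ : A → O.Colour} {d : O.Colour},
      O.Op c₀ d → Prop} {I : Type} [Finite I] {c : I → O.Colour} {d : O.Colour} {x : O.Op c d}
    (hx : Generated O G x) : ∀ {J : I → Type} [∀ i, Finite (J i)] {b : ∀ i, J i → O.Colour}
    (y : ∀ i, O.Op (b i) (c i)), (∀ i, Generated O G (y i)) → Generated O G (O.comp x y) := by
  induction hx with
  | unit d =>
    intro J _ b y hy
    exact (O.unit_comp (y ())).symm ▸ .reindex _ _ (hy ())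
  | graft p hp q _ ih =>
    intro J _ b y hy
    rw [comp_comp]
    exact .reindex _ _ (.graft p hp _ fun a => ih a _ fun j => hy ⟨a, j⟩)
  | reindex σ x _ ih =>
    intro J _ b y hy
    rw [reindex_comp]
    exact .reindex _ _ (ih _ fun i => hy (σ i))

end SymOperad

/-! ### Operations of the tensor product of two open trees -/

instance (T : Tree) : PartialOrder T.operad.Colour :=
  inferInstanceAs (PartialOrder T.Edge)

/-- The operad `Ω(S) ⊗ Ω(T)`. -/
noncomputable abbrev bv (S T : Tree) : SymOperad := bvTensor S.operad T.operad

instance (S T : Tree) : PartialOrder (bv S T).Colour :=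
  inferInstanceAs (PartialOrder (S.Edge × T.Edge))

instance (S T : Tree) : Finite (bv S T).Colour :=
  inferInstanceAs (Finite (S.Edge × T.Edge))

section BV

variable {S T : Tree}

theorem BVTerm.isCut (hS : S.IsOpen) (hT : T.IsOpen) {I : Type} [Finite I]
    {c : I → S.operad.Colour × T.operad.Colour} {d : S.operad.Colour × T.operad.Colour}
    (p : BVTerm S.operad T.operad c d) : IsCut c d := by
  induction p with
  | left p y => exact (p.down.down.isCut hS).prodLeft y
  | right x q => exact (q.down.down.isCut hT).prodRight x
  | unit d => exact isCut_unit d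
  | reindex σ _ ih => exact ih.reindex σ
  | comp _ _ ih ih' => exact ih.comp ih'

theorem isCut_of_op (hS : S.IsOpen) (hT : T.IsOpen) {I : Type} [Finite I]
    {c : I → (bv S T).Colour} {d : (bv S T).Colour} (x : (bv S T).Op c d) : IsCut c d :=
  x.out.isCut hS hT

/-- The operation of `Ω(T)` corresponding to the vertex `v`. -/
def Tree.vertexOp (T : Tree) (v : T.Vertex) :
    T.operad.Op (fun a : T.Input v => (a.1 : T.operad.Colour)) (T.out v) :=
  ⟨⟨.reindex (Equiv.sigmaUnique (T.Input v) fun _ => Unit)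
    (.graft v (b := fun a _ => a.1) fun a => .edge a.1)⟩⟩

/-- The colour `(s, t)` of `Ω(S) ⊗ Ω(T)`. -/
abbrev pair (s : S.Edge) (t : T.Edge) : (bv S T).Colour := (s, t)

/-- The operation `v ⊗ t`. -/
noncomputable def leftVertex (v : S.Vertex) (t : T.Edge) :
    (bv S T).Op (fun a : S.Input v => pair a.1 t) (pair (S.out v) t) :=
  Quotient.mk _ (BVTerm.left (Q := T.operad) (S.vertexOp v) t)

/-- The operation `s ⊗ w`. -/
noncomputable def rightVertex (s : S.Edge) (w : T.Vertex) :
    (bv S T).Op (fun a : T.Input w => pair s a.1) (pair s (T.out w)) :=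
  Quotient.mk _ (BVTerm.right (P := S.operad) s (T.vertexOp w))

/-- The operations `v ⊗ t` and `s ⊗ w`, for vertices `v` of `S` and `w` of `T`. -/
inductive IsVertexOp (S T : Tree) : {A : Type} → [Finite A] → {c₀ : A → (bv S T).Colour} →
    {d : (bv S T).Colour} → (bv S T).Op c₀ d → Prop
  | left (v : S.Vertex) (t : T.Edge) : IsVertexOp S T (leftVertex v t)
  | right (s : S.Edge) (w : T.Vertex) : IsVertexOp S T (rightVertex s w)

theorem Tree.HasSubtree.generated_left {I : Type} {c : I → S.Edge} {d : S.Edge}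
    (h : S.HasSubtree c d) (t : T.Edge) : ∀ [Finite I], (bv S T).Generated (IsVertexOp S T)
      (Quotient.mk _ (BVTerm.left (P := S.operad) (Q := T.operad) (c := c) (d := d) ⟨⟨h⟩⟩ t)) := by
  induction h with
  | edge e =>
    intro _
    refine cast (congrArg ((bv S T).Generated (IsVertexOp S T)) (Quotient.sound
      (BVRel.left_unit (P := S.operad) (Q := T.operad) e t)).symm) ?_
    exact .unit (O := bv S T) (pair e t)
  | @graft v J b h ih =>
    intro _
    have hJ (a) : Finite (J a) := .of_injective (Sigma.mk a) sigma_mk_injective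
    refine cast (congrArg ((bv S T).Generated (IsVertexOp S T)) ((bvComp_mk _ _).trans
      (Quotient.sound (BVRel.left_comp (P := S.operad) (Q := T.operad) (S.vertexOp v)
        (fun a => ⟨⟨h a⟩⟩) t).symm))) ?_
    exact .graft (O := bv S T) _ (.left v t) _ fun a => ih a
  | @reindex I J σ c d h ih =>
    intro _
    have : Finite I := .of_equiv J σ.symm
    refine cast (congrArg ((bv S T).Generated (IsVertexOp S T)) (Quotient.sound
      (BVRel.left_reindex (P := S.operad) (Q := T.operad) σ (c := c) ⟨⟨h⟩⟩ t)).symm) ?_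
    exact .reindex (O := bv S T) σ (c := fun j => pair (c j) t) (d := pair d t) _ ih

theorem Tree.HasSubtree.generated_right {I : Type} {c : I → T.Edge} {d : T.Edge}
    (h : T.HasSubtree c d) (s : S.Edge) : ∀ [Finite I], (bv S T).Generated (IsVertexOp S T)
      (Quotient.mk _ (BVTerm.right (P := S.operad) (Q := T.operad) (c := c) (d := d) s ⟨⟨h⟩⟩)) := by
  induction h with
  | edge e =>
    intro _
    refine cast (congrArg ((bv S T).Generated (IsVertexOp S T)) (Quotient.sound
      (BVRel.right_unit (P := S.operad) (Q := T.operad) s e)).symm) ?_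
    exact .unit (O := bv S T) (pair s e)
  | @graft w J b h ih =>
    intro _
    have hJ (a) : Finite (J a) := .of_injective (Sigma.mk a) sigma_mk_injective
    refine cast (congrArg ((bv S T).Generated (IsVertexOp S T)) ((bvComp_mk _ _).trans
      (Quotient.sound (BVRel.right_comp (P := S.operad) (Q := T.operad) s (T.vertexOp w)
        (fun a => ⟨⟨h a⟩⟩)).symm))) ?_
    exact .graft (O := bv S T) _ (.right s w) _ fun a => ih a
  | @reindex I J σ c d h ih =>
    intro _
    have : Finite I := .of_equiv J σ.symm
    refine cast (congrArg ((bv S T).Generated (IsVertexOp S T)) (Quotient.sound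
      (BVRel.right_reindex (P := S.operad) (Q := T.operad) σ (c := c) s ⟨⟨h⟩⟩)).symm) ?_
    exact .reindex (O := bv S T) σ (c := fun j => pair s (c j)) (d := pair s d) _ ih

theorem generated {I : Type} [Finite I] {c : I → (bv S T).Colour} {d : (bv S T).Colour}
    (x : (bv S T).Op c d) : (bv S T).Generated (IsVertexOp S T) x := by
  obtain ⟨p, rfl⟩ := Quotient.exists_rep x
  change BVTerm S.operad T.operad c d at p
  induction p with
  | left p y => exact p.down.down.generated_left y
  | right x q => exact q.down.down.generated_right x
  | unit d => exact .unit (O := bv S T) d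
  | reindex σ _ ih => exact .reindex (O := bv S T) σ _ ih
  | comp p q ih ih' =>
    refine cast (congrArg ((bv S T).Generated (IsVertexOp S T)) (bvComp_mk _ _)) ?_
    exact .comp (O := bv S T) ih _ ih'

end BV

open SymOperad

/-- For a nontrivial cut in a product of open trees, it is not possible that one member has the
same first coordinate as the root and another one the same second coordinate. Hence a vertex of
one of the two trees can be chosen as the root vertex of the corresponding operation. -/
theorem IsCut.lt_or_lt {S T : Tree} {I : Type} {c : I → S.Edge × T.Edge} {d : S.Edge × T.Edge}
    (h : IsCut c d) : (∃ i, c i = d) ∨ (∀ i, d.1 < (c i).1) ∨ ∀ i, d.2 < (c i).2 := by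
  by_contra! ⟨h₁, ⟨i, hi⟩, j, hj⟩
  have hi' : d.1 = (c i).1 := (h.le i).1.eq_of_not_lt hi
  have hj' : d.2 = (c j).2 := (h.le j).2.eq_of_not_lt hj
  obtain rfl : i = j := h.eq_of_compat
    ⟨((c j).1, (c i).2), ⟨hi' ▸ (h.le j).1, le_rfl⟩, ⟨le_rfl, hj' ▸ (h.le i).2⟩⟩
  exact h₁ i (Prod.ext hi'.symm hj'.symm)

section Unique

variable {S T : Tree} {I : Type} [Finite I] {c : I → (bv S T).Colour} {d : (bv S T).Colour}

theorem hasRoot_interchange (v : S.Vertex) (w : T.Vertex) :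
    HasRoot (leftVertex v (T.out w))
      ((bv S T).comp (rightVertex (S.out v) w) fun l => leftVertex v l.1) := by
  let σ : (Σ _ : S.Input v, T.Input w) ≃ Σ _ : T.Input w, S.Input v :=
    ⟨fun x => ⟨x.2, x.1⟩, fun x => ⟨x.2, x.1⟩, fun _ => rfl, fun _ => rfl⟩
  have h : (bv S T).reindex σ (c := fun x => pair x.2.1 x.1.1)
      ((bv S T).comp (leftVertex v (T.out w)) fun a => rightVertex a.1 w) =
      (bv S T).comp (rightVertex (S.out v) w) fun l => leftVertex v l.1 :=
    (congrArg ((bv S T).reindex σ (c := fun x => pair x.2.1 x.1.1)) (bvComp_mk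
      (BVTerm.left (Q := T.operad) (S.vertexOp v) (T.out w))
      fun a : S.Input v => BVTerm.right (P := S.operad) a.1 (T.vertexOp w))).trans <|
    (Quotient.sound (s := BVTerm.setoid _ _ _ _) (BVRel.interchange (P := S.operad)
      (Q := T.operad) (S.vertexOp v) (T.vertexOp w))).trans
    (bvComp_mk (BVTerm.right (P := S.operad) (S.out v) (T.vertexOp w))
      fun l : T.Input w => BVTerm.left (Q := T.operad) (S.vertexOp v) l.1).symm
  rw [← h]
  exact .reindex _ (.of_comp _)

/-- The operation `x` has an operation `v ⊗ t` at its root. -/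
def LeftRoot (x : (bv S T).Op c d) : Prop :=
  ∃ (v : S.Vertex) (t : T.Edge) (h : pair (S.out v) t = d),
    HasRoot (O := bv S T) (h ▸ leftVertex v t) x

/-- The operation `x` has an operation `s ⊗ w` at its root. -/
def RightRoot (x : (bv S T).Op c d) : Prop :=
  ∃ (s : S.Edge) (w : T.Vertex) (h : pair s (T.out w) = d),
    HasRoot (O := bv S T) (h ▸ rightVertex s w) x

/-- The operation `x` is a relabelled unit. -/
def IsTrivial (x : (bv S T).Op c d) : Prop :=
  ∃ (σ : Unit ≃ I) (h : (fun _ => d) = c), x = (bv S T).reindex σ (h ▸ (bv S T).unit d)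

theorem LeftRoot.hasRoot {v : S.Vertex} {t : T.Edge} {x : (bv S T).Op c (pair (S.out v) t)}
    (h : LeftRoot x) : HasRoot (leftVertex v t) x := by
  obtain ⟨v', t', h, hx⟩ := h
  obtain rfl : v' = v := S.out_injective (congrArg Prod.fst h)
  obtain rfl : t' = t := congrArg Prod.snd h
  exact hx

theorem RightRoot.hasRoot {s : S.Edge} {w : T.Vertex} {x : (bv S T).Op c (pair s (T.out w))}
    (h : RightRoot x) : HasRoot (rightVertex s w) x := by
  obtain ⟨s', w', h, hx⟩ := h
  obtain rfl : s' = s := congrArg Prod.fst h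
  obtain rfl : w' = w := T.out_injective (congrArg Prod.snd h)
  exact hx

theorem root_cases (x : (bv S T).Op c d) : IsTrivial x ∨ LeftRoot x ∨ RightRoot x := by
  induction generated x with
  | unit d => exact .inl ⟨Equiv.refl _, rfl, ((bv S T).reindex_refl _).symm⟩
  | graft p hp q _ _ =>
    cases hp with
    | left v t => exact .inr (.inl ⟨v, t, rfl, .of_comp q⟩)
    | right s w => exact .inr (.inr ⟨s, w, rfl, .of_comp q⟩)
  | @reindex I J _ _ σ c d x _ ih =>
    rcases ih with ⟨τ, h, rfl⟩ | ⟨v, t, h, hx⟩ | ⟨s, w, h, hx⟩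
    · obtain rfl : c = fun _ => d := funext fun j => by
        simpa using (congrFun h (σ.symm j)).symm
      exact .inl ⟨τ.trans σ, rfl, (bv S T).reindex_reindex τ σ _⟩
    · exact .inr (.inl ⟨v, t, h, hx.reindex σ⟩)
    · exact .inr (.inr ⟨s, w, h, hx.reindex σ⟩)

theorem IsTrivial.eq {x y : (bv S T).Op c d} (hx : IsTrivial x) (hy : IsTrivial y) : x = y := by
  obtain ⟨σ, rfl, rfl⟩ := hx
  obtain ⟨τ, _, rfl⟩ := hy
  obtain rfl : σ = τ := Equiv.ext fun _ => σ.symm.injective (Subsingleton.elim _ _)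
  rfl

theorem IsTrivial.colour_eq {x : (bv S T).Op c d} (hx : IsTrivial x) (i : I) : c i = d := by
  obtain ⟨-, h, -⟩ := hx
  exact (congrFun h i).symm

theorem LeftRoot.lt (hS : S.IsOpen) (hT : T.IsOpen) {x : (bv S T).Op c d} (hx : LeftRoot x)
    (i : I) : (d.1 : S.Edge) < (c i).1 := by
  obtain ⟨v, t, rfl, J, _, σ, q, -⟩ := hx
  obtain ⟨⟨a, j⟩, rfl⟩ := σ.surjective i
  exact (S.out_lt a).trans_le ((isCut_of_op hS hT (q a)).le j).1

theorem RightRoot.lt (hS : S.IsOpen) (hT : T.IsOpen) {x : (bv S T).Op c d} (hx : RightRoot x)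
    (i : I) : (d.2 : T.Edge) < (c i).2 := by
  obtain ⟨s, w, rfl, J, _, σ, q, -⟩ := hx
  obtain ⟨⟨a, j⟩, rfl⟩ := σ.surjective i
  exact (T.out_lt a).trans_le ((isCut_of_op hS hT (q a)).le j).2

/-- If the `S`-colours of the inputs of an operation are all strictly above that of the output,
then a vertex of `S` can be moved to its root by interchange. -/
theorem leftRoot_of_lt (hT : T.IsOpen) (x : (bv S T).Op c d)
    (hlt : ∀ i, (d.1 : S.Edge) < (c i).1) :
    LeftRoot x := by
  induction generated x with
  | unit d => exact (lt_irrefl _ (hlt ())).elim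
  | graft p hp q _ ih =>
    cases hp with
    | left v t => exact ⟨v, t, rfl, .of_comp q⟩
    | right s w =>
      have hq (l) : LeftRoot (q l) := ih l fun j => hlt ⟨l, j⟩
      obtain ⟨l⟩ := hT w
      obtain ⟨v, t, h, -⟩ := hq l
      obtain rfl : S.out v = s := congrArg Prod.fst h
      exact ⟨v, T.out w, rfl, .of_interchange (hasRoot_interchange v w) q fun l => (hq l).hasRoot⟩
  | reindex σ x _ ih =>
    obtain ⟨v, t, h, hx⟩ := ih fun i => hlt (σ i)
    exact ⟨v, t, h, hx.reindex σ⟩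

/-- For open trees `S` and `T`, an operation of `Ω(S) ⊗ Ω(T)` is determined by its inputs and its
output. -/
theorem op_eq (hS : S.IsOpen) (hT : T.IsOpen) (x y : (bv S T).Op c d) : x = y := by
  induction d using WellFoundedGT.induction generalizing I with
  | ind d ih =>
    have hc {I : Type} [Finite I] {c : I → (bv S T).Colour} {d : (bv S T).Colour}
      (x : (bv S T).Op c d) : IsCut c d := isCut_of_op hS hT x
    by_cases hlt : ∀ i, (d.1 : S.Edge) < (c i).1
    · have hx := leftRoot_of_lt hT x hlt
      have hy := leftRoot_of_lt hT y hlt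
      obtain ⟨v, t, rfl, -⟩ := id hx
      obtain ⟨_, q, rfl⟩ := hx.hasRoot.exists_eq hc
      obtain ⟨_, q', rfl⟩ := hy.hasRoot.exists_eq hc
      have : q = q' := funext fun a => ih _ (Prod.mk_lt_mk_iff_left.2 (S.out_lt a)) _ _
      rw [this]
    · -- an input with the same `S`-colour as the output excludes a vertex of `S` at the root
      have hl (x : (bv S T).Op c d) : ¬ LeftRoot x := fun h => hlt (h.lt hS hT)
      rcases root_cases x with hx | hx | hx
      · rcases root_cases y with hy | hy | hy
        · exact hx.eq hy
        · exact (hl y hy).elim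
        · obtain ⟨i⟩ := (hc x).nonempty
          have := hy.lt hS hT i
          rw [hx.colour_eq i] at this
          exact (lt_irrefl _ this).elim
      · exact (hl x hx).elim
      · rcases root_cases y with hy | hy | hy
        · obtain ⟨i⟩ := (hc x).nonempty
          have := hx.lt hS hT i
          rw [hy.colour_eq i] at this
          exact (lt_irrefl _ this).elim
        · exact (hl y hy).elim
        · obtain ⟨s, w, rfl, -⟩ := id hx
          obtain ⟨_, q, rfl⟩ := hx.hasRoot.exists_eq hc
          obtain ⟨_, q', rfl⟩ := hy.hasRoot.exists_eq hc
          have : q = q' := funext fun a => ih _ (Prod.mk_lt_mk_iff_right.2 (T.out_lt a)) _ _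
          rw [this]

theorem IsCut.nonempty_op (hS : S.IsOpen) (hT : T.IsOpen) (h : IsCut c d) :
    Nonempty ((bv S T).Op c d) := by
  induction d using WellFoundedGT.induction generalizing I with
  | ind d ih =>
    obtain ⟨i₀⟩ := h.nonempty
    rcases IsCut.lt_or_lt (c := c) (d := d) h with ⟨i, hi⟩ | hlt | hlt
    · have := h.subsingleton_of_eq hi
      obtain rfl : c = fun _ => d := funext fun j => Subsingleton.elim i j ▸ hi
      let σ : Unit ≃ I := ⟨fun _ => i, fun _ => (), fun _ => rfl, fun _ => Subsingleton.elim _ _⟩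
      exact ⟨(bv S T).reindex σ ((bv S T).unit d)⟩
    · obtain ⟨s, t⟩ := d
      obtain ⟨v, rfl, -⟩ := S.exists_vertex_of_lt (hlt i₀)
      have hv := isCut_of_op hS hT (leftVertex (T := T) v t)
      have hle (i) : ∃ a : S.Input v, pair a.1 t ≤ c i :=
        let ⟨a, ha⟩ := S.exists_input_le (hlt i)
        ⟨a, ha, (h.le i).2⟩
      have key (a) := ih _ (Prod.mk_lt_mk_iff_left.2 (S.out_lt a)) (h.restrict hv hle a)
      exact ⟨(bv S T).reindex (hv.refineEquiv c hle)
        ((bv S T).comp (leftVertex v t) fun a => (key a).some)⟩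
    · obtain ⟨s, t⟩ := d
      obtain ⟨w, rfl, -⟩ := T.exists_vertex_of_lt (hlt i₀)
      have hw := isCut_of_op hS hT (rightVertex (S := S) s w)
      have hle (i) : ∃ a : T.Input w, pair s a.1 ≤ c i :=
        let ⟨a, ha⟩ := T.exists_input_le (hlt i)
        ⟨a, (h.le i).1, ha⟩
      have key (a) := ih _ (Prod.mk_lt_mk_iff_right.2 (T.out_lt a)) (h.restrict hw hle a)
      exact ⟨(bv S T).reindex (hw.refineEquiv c hle)
        ((bv S T).comp (rightVertex s w) fun a => (key a).some)⟩

end Unique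

/-! ### Operads of cuts -/

/-- An order embedding which moreover reflects compatibility. -/
structure IsCompatEmbedding {P Q : Type*} [Preorder P] [Preorder Q] (f : P → Q) : Prop where
  le_iff_le {a b : P} : f a ≤ f b ↔ a ≤ b
  compat {a b : P} : Compat (f a) (f b) → Compat a b

theorem IsCompatEmbedding.isCut {P Q : Type*} [Preorder P] [Preorder Q] {f : P → Q}
    (hf : IsCompatEmbedding f) {I : Type*} {c : I → P} {d : P}
    (h : IsCut (fun i => f (c i)) (f d)) : IsCut c d where
  le i := hf.le_iff_le.1 (h.le i)
  eq_of_compat := fun ⟨q, hi, hj⟩ =>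
    h.eq_of_compat ⟨f q, hf.le_iff_le.2 hi, hf.le_iff_le.2 hj⟩
  exists_compat hp :=
    let ⟨i, hi⟩ := h.exists_compat (hf.le_iff_le.2 hp)
    ⟨i, hf.compat hi⟩

theorem IsCompatEmbedding.injective {P Q : Type*} [PartialOrder P] [Preorder Q] {f : P → Q}
    (hf : IsCompatEmbedding f) : Function.Injective f :=
  fun _ _ h => le_antisymm (hf.le_iff_le.1 h.le) (hf.le_iff_le.1 h.ge)

theorem IsCompatEmbedding.prodMap {P Q P' Q' : Type*} [Preorder P] [Preorder Q] [Preorder P']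
    [Preorder Q'] {f : P → Q} {f' : P' → Q'} (hf : IsCompatEmbedding f)
    (hf' : IsCompatEmbedding f') : IsCompatEmbedding (Prod.map f f') where
  le_iff_le := and_congr hf.le_iff_le hf'.le_iff_le
  compat h := .prod (hf.compat h.fst) (hf'.compat h.snd)

theorem IsCompatEmbedding.prodSwap {P Q : Type*} [Preorder P] [Preorder Q] :
    IsCompatEmbedding (Prod.swap : P × Q → Q × P) where
  le_iff_le := Prod.swap_le_swap
  compat h := .prod h.snd h.fst

namespace SymOperad

/-- An operad with ordered colours is an operad of cuts if its operations are exactly the cuts. -/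
structure IsCutOperad (O : SymOperad) [Preorder O.Colour] : Prop where
  isCut {I : Type} [Finite I] {c : I → O.Colour} {d : O.Colour} : O.Op c d → IsCut c d
  op_eq {I : Type} [Finite I] {c : I → O.Colour} {d : O.Colour} (x y : O.Op c d) : x = y
  nonempty_op {I : Type} [Finite I] {c : I → O.Colour} {d : O.Colour} :
    IsCut c d → Nonempty (O.Op c d)

theorem isCutOperad_tree {T : Tree} (hT : T.IsOpen) : T.operad.IsCutOperad where
  isCut x := x.down.down.isCut hT
  op_eq | ⟨⟨_⟩⟩, ⟨⟨_⟩⟩ => rfl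
  nonempty_op h := ⟨⟨⟨h.hasSubtree hT⟩⟩⟩

theorem isCutOperad_bv {S T : Tree} (hS : S.IsOpen) (hT : T.IsOpen) : (bv S T).IsCutOperad where
  isCut := isCut_of_op hS hT
  op_eq := op_eq hS hT
  nonempty_op := IsCut.nonempty_op hS hT

variable {N P O : SymOperad} [PartialOrder P.Colour] [PartialOrder O.Colour]

theorem IsCutOperad.hom_ext (hO : O.IsCutOperad) {f g : N ⟶ O}
    (h : Hom.colour f = Hom.colour g) : f = g := by
  obtain ⟨f, f', _, _, _⟩ := f
  obtain ⟨g, g', _, _, _⟩ := g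
  obtain rfl : f = g := h
  refine Hom.ext rfl (heq_of_eq ?_)
  funext I _ c d x
  exact hO.op_eq _ _

/-- A map to an operad of cuts is a map on colours which sends all operations to cuts. -/
noncomputable def IsCutOperad.mkHom (hO : O.IsCutOperad) (f : N.Colour → O.Colour)
    (hf : ∀ {I : Type} [Finite I] {c : I → N.Colour} {d : N.Colour},
      N.Op c d → IsCut (fun i => f (c i)) (f d)) : N ⟶ O where
  colour := f
  onOp x := (hO.nonempty_op (hf x)).some
  onOp_unit _ := hO.op_eq _ _
  onOp_reindex _ _ _ _ := hO.op_eq _ _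
  onOp_comp _ _ := hO.op_eq _ _

theorem IsCutOperad.exists_lift (hP : P.IsCutOperad) (hO : O.IsCutOperad) {i : P ⟶ O}
    (hi : IsCompatEmbedding (Hom.colour i)) (f : N ⟶ O)
    (hf : ∀ e, ∃ e', Hom.colour i e' = Hom.colour f e) : ∃ g : N ⟶ P, g ≫ i = f := by
  choose g hg using hf
  refine ⟨hP.mkHom g fun x => hi.isCut ?_, hO.hom_ext (funext hg)⟩
  simpa only [hg] using hO.isCut (Hom.onOp f x)

theorem IsCutOperad.eq_of_comp_eq (hP : P.IsCutOperad) {i : P ⟶ O}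
    (hi : IsCompatEmbedding (Hom.colour i)) {f g : N ⟶ P} (h : f ≫ i = g ≫ i) : f = g :=
  hP.hom_ext (funext fun e => hi.injective (congrFun (congrArg Hom.colour h) e))

section

variable {R : Tree}

/-- The map on colours of a map `f` from the operad of a tree. -/
abbrev edgeMap (f : R.operad ⟶ O) : R.Edge → O.Colour := Hom.colour f

theorem edgeMap_monotone (hO : O.IsCutOperad) (f : R.operad ⟶ O) : Monotone (edgeMap f) := by
  intro a b h
  induction (Tree.le_def.1 h) using Relation.ReflTransGen.head_induction_on with
  | refl => exact le_rfl
  | head h' _ ih =>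
    obtain ⟨v, hv, rfl⟩ := h'
    exact (ih (by assumption)).trans ((hO.isCut (Hom.onOp f (R.vertexOp v))).le ⟨_, hv⟩)

theorem isOpen_of_hom (hO : O.IsCutOperad) (f : R.operad ⟶ O) : R.IsOpen :=
  fun v => (hO.isCut (Hom.onOp f (R.vertexOp v))).nonempty

theorem isCut_edgeMap (hO : O.IsCutOperad) (f : R.operad ⟶ O)
    {I : Type} [Finite I] {c : I → R.Edge} {d : R.Edge} (h : IsCut c d) :
    IsCut (fun i => edgeMap f (c i)) (edgeMap f d) :=
  hO.isCut (Hom.onOp f ⟨⟨h.hasSubtree (isOpen_of_hom hO f)⟩⟩)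

/-- Incomparable edges belong to a common cut above the root, so that they have incompatible
images. -/
theorem compat_of_compat_edgeMap (hO : O.IsCutOperad) (f : R.operad ⟶ O)
    {a b : R.Edge} (h : Compat (edgeMap f a) (edgeMap f b)) :
    Compat a b := by
  by_contra hab
  rw [Tree.compat_iff, not_or] at hab
  have hcut := isCut_edgeMap hO f (R.isCut_of_antichain (A := {a, b}) <| by
    rintro x (rfl | rfl) y (rfl | rfl) hxy
    exacts [rfl, (hab.1 hxy).elim, (hab.2 hxy).elim, rfl])
  have := hcut.eq_of_compat (i := ⟨a, .inl (.inl rfl)⟩) (j := ⟨b, .inl (.inr rfl)⟩) h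
  exact hab.1 (congrArg Subtype.val this).le

theorem isCompatEmbedding_edgeMap (hO : O.IsCutOperad) (f : R.operad ⟶ O)
    (hf : Function.Injective (edgeMap f)) :
    IsCompatEmbedding (edgeMap f) where
  le_iff_le {a b} := by
    refine ⟨fun h => ?_, fun h => edgeMap_monotone hO f h⟩
    rcases Tree.compat_iff.1 (compat_of_compat_edgeMap hO f (.of_le h)) with h' | h'
    · exact h'
    · exact (hf (h.antisymm (edgeMap_monotone hO f h'))).le
  compat := compat_of_compat_edgeMap hO f

/-- An automorphism of a tree over an operad of cuts is trivial: it is an automorphism of the poset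
of edges, and the inputs of a vertex have different colours. -/
theorem edgeMap_eq_self (hO : O.IsCutOperad) (f : R.operad ⟶ O)
    (σ τ : R ⟶ R) (hτσ : τ ≫ σ = 𝟙 R) (hστ : σ ≫ τ = 𝟙 R)
    (hσ : treeOperad.map σ ≫ f = f) (e : R.Edge) : Hom.colour σ e = e := by
  have hR := isCutOperad_tree (isOpen_of_hom hO f)
  let s : R.Edge → R.Edge := Hom.colour σ
  let t : R.Edge → R.Edge := Hom.colour τ
  have hs : Monotone s := edgeMap_monotone hR (R := R) σ
  have ht : Monotone t := edgeMap_monotone hR (R := R) τ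
  have hst (e) : s (t e) = e := congrFun (congrArg Hom.colour hτσ) e
  have hts (e) : t (s e) = e := congrFun (congrArg Hom.colour hστ) e
  have hfs (e) : edgeMap f (s e) = edgeMap f e := congrFun (congrArg Hom.colour hσ) e
  have hs' : StrictMono s := hs.strictMono_of_injective (Function.LeftInverse.injective hts)
  have ht' : StrictMono t := ht.strictMono_of_injective (Function.LeftInverse.injective hst)
  change s e = e
  induction R.reaches_root e using Relation.ReflTransGen.head_induction_on with
  | refl => exact le_bot_iff.1 ((hs bot_le).trans_eq (hst ⊥))
  | @head e e' h _ ih =>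
    obtain ⟨v, hv, rfl⟩ := h
    let a : R.Input v := ⟨e, hv⟩
    -- `s e ≥ b` and `e ≥ t b ≥ a'` for inputs `b` and `a'` of `v`, so that `a' = e` and `s e = b`
    obtain ⟨b, hb⟩ := R.exists_input_le (ih.symm.trans_lt (hs' (R.out_lt a)))
    have hta : t (R.out v) = R.out v := (congrArg t ih).symm.trans (hts _)
    obtain ⟨a', ha'⟩ := R.exists_input_le (hta.symm.trans_lt (ht' (R.out_lt b)))
    have hle : t b.1 ≤ a.1 := (ht hb).trans_eq (hts e)
    rw [R.input_eq (ha'.trans hle)] at ha'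
    have hsb : s e = b.1 := le_antisymm ((hs ha').trans_eq (hst _)) hb
    have := (hO.isCut (Hom.onOp f (R.vertexOp v))).eq_of_compat (i := a) (j := b)
      (.of_le ((hfs e).symm.trans (congrArg _ hsb)).le)
    rw [hsb, ← this]

end

end SymOperad

/-! ### Faces of a tree -/

theorem covBy_unique {P : Type*} [PartialOrder P]
    (hP : ∀ a b c : P, a ≤ c → b ≤ c → a ≤ b ∨ b ≤ a) {a b c : P}
    (ha : a ⋖ c) (hb : b ⋖ c) : a = b := by
  rcases hP a b c ha.le hb.le with h | h
  · exact h.eq_or_lt.resolve_right fun h => ha.2 h hb.lt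
  · exact (h.eq_or_lt.resolve_right fun h => hb.2 h ha.lt).symm

section PosetTree

variable {P : Type} [PartialOrder P] [Finite P]

theorem exists_le_covBy {a b : P} (h : a < b) : ∃ m, a ≤ m ∧ m ⋖ b := by
  obtain ⟨m, ham, hm⟩ := Finite.exists_le_maximal (p := (· < b)) h
  exact ⟨m, ham, hm.1, fun x hx hxb => hx.not_ge (hm.2 hxb hx.le)⟩

theorem reflTransGen_covBy_of_le {a b : P} (h : a ≤ b) :
    Relation.ReflTransGen (fun x y : P => y ⋖ x) b a := by
  induction b using WellFoundedLT.induction with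
  | ind b ih =>
    rcases h.eq_or_lt with rfl | h
    · exact .refl
    · obtain ⟨m, ham, hm⟩ := exists_le_covBy h
      exact .head hm (ih m hm.lt ham)

open Classical in
/-- The open tree with a given poset of edges. Its vertices are the elements which are not maximal,
the inputs of such an element being the elements covering it. -/
noncomputable def posetTree (P : Type) [PartialOrder P] [Finite P]
    (hP : ∀ a b c : P, a ≤ c → b ≤ c → a ≤ b ∨ b ≤ a) (r : P) (hr : ∀ p, r ≤ p) : Tree where
  Edge := P
  Vertex := {p : P // ¬ IsMax p}
  finite_edge := inferInstance
  finite_vertex := inferInstance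
  root := r
  out := Subtype.val
  out_injective := Subtype.val_injective
  below e := if h : ∃ m, m ⋖ e then some ⟨h.choose, h.choose_spec.lt.not_isMax⟩ else none
  below_eq_none_iff e := by
    rw [dite_eq_right_iff]
    refine ⟨fun h => by_contra fun he => ?_, ?_⟩
    · obtain ⟨m, -, hm⟩ := exists_le_covBy (lt_of_le_of_ne (hr e) (Ne.symm he))
      exact Option.some_ne_none _ (h ⟨m, hm⟩)
    · rintro rfl ⟨m, hm⟩
      exact (hm.lt.not_ge (hr m)).elim
  reaches_root e := by
    refine Relation.ReflTransGen.mono (fun x y h => ?_) _ _ (reflTransGen_covBy_of_le (hr e))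
    have hx : ∃ m, m ⋖ x := ⟨y, h⟩
    exact ⟨_, dif_pos hx, covBy_unique hP hx.choose_spec h⟩

variable {hP : ∀ a b c : P, a ≤ c → b ≤ c → a ≤ b ∨ b ≤ a} {r : P} {hr : ∀ p, r ≤ p}

open Classical in
theorem posetTree_below {v : (posetTree P hP r hr).Vertex} {e : P} :
    (posetTree P hP r hr).below e = some v ↔ (v.1 : P) ⋖ e := by
  change (if h : ∃ m, m ⋖ e then some _ else none) = some v ↔ _
  refine ⟨fun h => ?_, fun h => ?_⟩
  · obtain ⟨h, hv⟩ := Option.dite_none_right_eq_some.1 h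
    exact Option.some.inj hv ▸ h.choose_spec
  · have he : ∃ m, m ⋖ e := ⟨_, h⟩
    rw [dif_pos he]
    exact congrArg some (Subtype.ext (covBy_unique hP he.choose_spec h))

theorem posetTree_le {a b : P} : @LE.le (posetTree P hP r hr).Edge _ a b ↔ a ≤ b := by
  refine ⟨fun h => ?_, fun h => ?_⟩
  · induction (Tree.le_def.1 h) using Relation.ReflTransGen.head_induction_on with
    | refl => exact le_refl (α := P) _
    | @head b c h' h'' ih =>
      obtain ⟨v, hv, rfl⟩ := h'
      exact (ih (Tree.le_def.2 h'')).trans (posetTree_below.1 hv).le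
  · have key (x y : P) (hxy : y ⋖ x) : (posetTree P hP r hr).Step x y :=
      ⟨⟨y, hxy.lt.not_isMax⟩, posetTree_below.2 hxy, rfl⟩
    exact Relation.ReflTransGen.mono key _ _ (reflTransGen_covBy_of_le (P := P) h)

theorem posetTree_isOpen : (posetTree P hP r hr).IsOpen := by
  intro v
  obtain ⟨b, hb⟩ := not_isMax_iff.1 v.2
  obtain ⟨m, -, hm⟩ := Finite.exists_le_minimal (p := fun x : P => v.1 < x) hb
  exact ⟨m, posetTree_below.2 ⟨hm.1, fun x hx hxm => hxm.not_ge (hm.2 hx hxm.le)⟩⟩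

end PosetTree

/-- A set of edges of an open tree `S` is facial if it is the set of edges of a face of `S`: it has
a least element, and the elements of `D` following a nonmaximal element `d` of `D` are a cut
above `d`. -/
structure Tree.IsFacial (S : Tree) (D : Set S.Edge) : Prop where
  exists_le : ∃ r : D, ∀ d : D, r ≤ d
  exists_compat {d d' e : S.Edge} : d ∈ D → d' ∈ D → d < d' → d ≤ e → ∃ x ∈ D, d < x ∧ Compat e x

namespace Tree

variable {S : Tree} {D : Set S.Edge}

/-- The face of `S` with a given set of edges. -/
noncomputable def face (S : Tree) {D : Set S.Edge} (hD : S.IsFacial D) : Tree :=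
  posetTree D (fun a b _ ha hb => S.le_total_of_le (a := a) (b := b) ha hb) hD.exists_le.choose
    hD.exists_le.choose_spec

/-- The inclusion of the edges of a face. -/
def faceEdge (hD : S.IsFacial D) : (S.face hD).Edge → S.Edge := Subtype.val (p := (· ∈ D))

theorem face_isOpen (hD : S.IsFacial D) : (S.face hD).IsOpen := posetTree_isOpen

theorem faceEdge_le_faceEdge (hD : S.IsFacial D) {a b : (S.face hD).Edge} :
    faceEdge hD a ≤ faceEdge hD b ↔ a ≤ b :=
  (posetTree_le (P := D) (a := a) (b := b)).symm

theorem isCompatEmbedding_faceEdge (hD : S.IsFacial D) : IsCompatEmbedding (faceEdge hD) where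
  le_iff_le := faceEdge_le_faceEdge hD
  compat h := by
    rw [compat_iff] at h ⊢
    simpa only [faceEdge_le_faceEdge] using h

theorem isCut_faceEdge (hD : S.IsFacial D) {I : Type} {c : I → (S.face hD).Edge}
    {d : (S.face hD).Edge} (h : IsCut c d) :
    IsCut (fun i => faceEdge hD (c i)) (faceEdge hD d) where
  le i := (faceEdge_le_faceEdge hD).2 (h.le i)
  eq_of_compat hij := h.eq_of_compat ((isCompatEmbedding_faceEdge hD).compat hij)
  exists_compat {e} he := by
    -- a maximal edge `x` of the face which is compatible with `e`
    obtain ⟨x, hdx, ⟨hex, hx⟩⟩ := Finite.exists_le_maximal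
      (p := fun x => Compat e (faceEdge hD x)) (a := d) (Compat.of_le he).symm
    obtain ⟨i, hi⟩ := h.exists_compat hdx
    refine ⟨i, compat_iff.2 ?_⟩
    rcases compat_iff.1 hi with hi | hi <;> rw [← faceEdge_le_faceEdge hD] at hi
    · rcases compat_iff.1 hex with hex | hex
      · exact .inl (hex.trans hi)
      · rcases hi.eq_or_lt with hi | hi
        · exact .inr (hi ▸ hex)
        · obtain ⟨y, hy, hxy, hey⟩ := hD.exists_compat x.2 (c i).2 hi hex
          have : (⟨y, hy⟩ : D) ≤ x := (faceEdge_le_faceEdge hD).2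
            (hx (y := (⟨y, hy⟩ : D)) hey ((faceEdge_le_faceEdge hD).1 hxy.le))
          exact (hxy.not_ge this).elim
    · rcases compat_iff.1 hex with hex | hex
      · exact S.le_total_of_le hex hi
      · exact .inr (hi.trans hex)

/-- The inclusion of a face. -/
noncomputable def faceι (hS : S.IsOpen) (hD : S.IsFacial D) : S.face hD ⟶ S :=
  (isCutOperad_tree hS).mkHom (N := (S.face hD).operad) (faceEdge hD)
    fun x => isCut_faceEdge hD (x.down.down.isCut (face_isOpen hD))

end Tree

section

variable {S T R : Tree}

/-- The `S`-colours appearing in a map `Ω(R) ⟶ Ω(S) ⊗ Ω(T)` form a facial set. Only the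
effect of the map on cuts above the root is used. -/
theorem isFacial_range_fst (f : R.Edge → S.Edge × T.Edge) (hf : Monotone f)
    (hcut : ∀ {I : Type} [Finite I] {c : I → R.Edge}, IsCut c ⊥ → IsCut (fun i => f (c i)) (f ⊥)) :
    S.IsFacial (Set.range fun e => (f e).1) where
  exists_le := by
    refine ⟨⟨(f ⊥).1, ⊥, rfl⟩, ?_⟩
    rintro ⟨-, e, rfl⟩
    exact (hf bot_le).1
  exists_compat := by
    rintro - - e ⟨r, rfl⟩ ⟨r', rfl⟩ hr he
    -- a member `i`, compatible with `(e, (f r').2)`, of the image of a cut containing `r'`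
    have hc := hcut (R.isCut_of_antichain (A := {r'}) (by rintro a rfl b rfl -; rfl))
    obtain ⟨⟨i, hi⟩, hfi⟩ := hc.exists_compat (p := (e, (f r').2))
      ⟨(hf bot_le).1.trans he, (hf bot_le).2⟩
    refine ⟨(f i).1, ⟨i, rfl⟩, ?_, hfi.fst⟩
    -- otherwise `f i` and `f r'` would be compatible, contradicting `i ≠ r'`
    by_contra hlt
    have hir : (f i).1 ≤ (f r).1 := by
      rcases Tree.compat_iff.1 (hfi.fst.mono he le_rfl) with h | h
      · exact (h.eq_of_not_lt hlt).ge
      · exact h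
    have := hc.eq_of_compat (i := ⟨i, hi⟩) (j := ⟨r', .inl rfl⟩)
      (.prod (.of_le (hir.trans hr.le)) hfi.snd.symm)
    obtain rfl : i = r' := congrArg Subtype.val this
    exact hr.not_ge hir

theorem isFacial_range_snd (f : R.Edge → S.Edge × T.Edge) (hf : Monotone f)
    (hcut : ∀ {I : Type} [Finite I] {c : I → R.Edge}, IsCut c ⊥ → IsCut (fun i => f (c i)) (f ⊥)) :
    T.IsFacial (Set.range fun e => (f e).2) :=
  isFacial_range_fst (fun e => (f e).swap) (fun _ _ h => Prod.swap_le_swap.2 (hf h))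
    fun h => IsCompatEmbedding.prodSwap.isCut (hcut h)

end

/-! ### Dendrices of a tensor product -/

section Lift

variable {S T F G R : Tree}

theorem isOpen_of_treeHom (hS : S.IsOpen) (i : F ⟶ S) : F.IsOpen :=
  isOpen_of_hom (isCutOperad_tree hS) (R := F) i

theorem isCompatEmbedding_colour (hS : S.IsOpen) {i : F ⟶ S}
    (hi : Function.Injective (Hom.colour i)) :
    IsCompatEmbedding (Hom.colour i : F.Edge → S.Edge) :=
  isCompatEmbedding_edgeMap (isCutOperad_tree hS) (R := F) i hi

/-- A map of open trees factors through any injective map whose image contains its edges. -/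
theorem exists_treeHom_lift (hS : S.IsOpen) {i : F ⟶ S} (hi : Function.Injective (Hom.colour i))
    (f : R ⟶ S) (hf : ∀ e, ∃ e', Hom.colour i e' = Hom.colour f e) : ∃ g : R ⟶ F, g ≫ i = f :=
  (isCutOperad_tree (isOpen_of_treeHom hS i)).exists_lift (isCutOperad_tree hS)
    (isCompatEmbedding_colour hS hi) (N := R.operad) f hf

theorem isCompatEmbedding_bvTensorMap (hS : S.IsOpen) (hT : T.IsOpen) {i : F ⟶ S} {j : G ⟶ T}
    (hi : Function.Injective (Hom.colour i)) (hj : Function.Injective (Hom.colour j)) :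
    IsCompatEmbedding
      (Hom.colour (bvTensorMap i j) : (bv F G).Colour → (bv S T).Colour) :=
  (isCompatEmbedding_colour hS hi).prodMap (isCompatEmbedding_colour hT hj)

end Lift

section Support

variable {S T R : Tree} (hS : S.IsOpen) (hT : T.IsOpen) (f : R.operad ⟶ bv S T)

/-- The edges of `S` appearing in a map `f : Ω(R) ⟶ Ω(S) ⊗ Ω(T)`. -/
def fstSupport (f : R.operad ⟶ bv S T) : Set S.Edge := Set.range fun e => (edgeMap f e).1

/-- The edges of `T` appearing in a map `f : Ω(R) ⟶ Ω(S) ⊗ Ω(T)`. -/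
def sndSupport (f : R.operad ⟶ bv S T) : Set T.Edge := Set.range fun e => (edgeMap f e).2

theorem isFacial_fstSupport (hS : S.IsOpen) (hT : T.IsOpen) (f : R.operad ⟶ bv S T) :
    S.IsFacial (fstSupport f) :=
  isFacial_range_fst (edgeMap f) (edgeMap_monotone (isCutOperad_bv hS hT) f)
    (isCut_edgeMap (isCutOperad_bv hS hT) f)

theorem isFacial_sndSupport (hS : S.IsOpen) (hT : T.IsOpen) (f : R.operad ⟶ bv S T) :
    T.IsFacial (sndSupport f) :=
  isFacial_range_snd (edgeMap f) (edgeMap_monotone (isCutOperad_bv hS hT) f)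
    (isCut_edgeMap (isCutOperad_bv hS hT) f)

/-- The smallest face of `S` supporting `f : Ω(R) ⟶ Ω(S) ⊗ Ω(T)`. -/
noncomputable def fstFace : Tree := S.face (isFacial_fstSupport hS hT f)

/-- The smallest face of `T` supporting `f : Ω(R) ⟶ Ω(S) ⊗ Ω(T)`. -/
noncomputable def sndFace : Tree := T.face (isFacial_sndSupport hS hT f)

/-- The inclusion of `fstFace`. -/
noncomputable def fstι : fstFace hS hT f ⟶ S := Tree.faceι hS _

/-- The inclusion of `sndFace`. -/
noncomputable def sndι : sndFace hS hT f ⟶ T := Tree.faceι hT _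

theorem fstι_injective : Function.Injective (Hom.colour (fstι hS hT f)) :=
  Subtype.val_injective (p := (· ∈ fstSupport f))

theorem sndι_injective : Function.Injective (Hom.colour (sndι hS hT f)) :=
  Subtype.val_injective (p := (· ∈ sndSupport f))

/-- Any map factors through the tensor product of its supporting faces. -/
theorem exists_face_lift : ∃ g : R.operad ⟶ bv (fstFace hS hT f) (sndFace hS hT f),
    g ≫ bvTensorMap (fstι hS hT f) (sndι hS hT f) = f :=
  (isCutOperad_bv (Tree.face_isOpen _) (Tree.face_isOpen _)).exists_lift (isCutOperad_bv hS hT)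
    (isCompatEmbedding_bvTensorMap hS hT (fstι_injective hS hT f) (sndι_injective hS hT f)) f
    fun e => ⟨(⟨_, e, rfl⟩, ⟨_, e, rfl⟩), rfl⟩

end Support

/-- A family of dendrices of `S`, given by a map `φ : A ⟶ Ω[S]`, is closed under supports if it
contains the inclusion of a face as soon as it contains a map whose image contains the edges of
this face. -/
structure IsSupported {S : Tree} {A : DSet} (φ : A ⟶ representable S) : Prop where
  injective (R : Tree) : Function.Injective (φ.app (.op R))
  exists_app_eq {F R : Tree} {i : F ⟶ S} (hi : Function.Injective (Hom.colour i))
    (x : A.obj (.op R))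
    (hx : ∀ e, ∃ e', Hom.colour (φ.app (.op R) x : R ⟶ S) e' = Hom.colour i e) :
    ∃ a : A.obj (.op F), φ.app (.op F) a = i

theorem isSupported_id (S : Tree) : IsSupported (𝟙 (representable S)) where
  injective _ _ _ h := h
  exists_app_eq _ _ _ := ⟨_, rfl⟩

theorem isSupported_boundary {S : Tree} (hS : S.IsOpen) : IsSupported (boundary S).ι where
  injective _ := Subtype.val_injective
  exists_app_eq := by
    rintro F R i - ⟨x, G, j, g, hj, rfl⟩ hx
    obtain ⟨h, hh⟩ := exists_treeHom_lift hS hj.1 i fun e =>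
      let ⟨e', he'⟩ := hx e
      ⟨Hom.colour g e', he'⟩
    exact ⟨⟨i, G, j, h, hj, hh⟩, rfl⟩

section Tensor

variable {S T : Tree} {A B : DSet} {φ : A ⟶ representable S} {ψ : B ⟶ representable T}

/-- The map `Ω(R) ⟶ Ω(S) ⊗ Ω(T)` underlying a dendrex of `Ω[S] ⊗ Ω[T]` of shape `R`. -/
noncomputable def evalTensor {S T R : Tree} :
    (tensorObj (representable S) (representable T)).obj (.op R) → (R.operad ⟶ bv S T) :=
  Quot.lift (fun z => z.f ≫ bvTensorMap z.x z.y) (by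
    rintro _ _ ⟨s, t, x, y, f⟩
    exact (congrArg (f ≫ ·) (bvTensorMap_comp s x t y)).trans (Category.assoc _ _ _).symm)

/-- If `φ` and `ψ` are closed under supports, then a dendrex of `A ⊗ B` is determined by the
underlying map `f : Ω(R) ⟶ Ω(S) ⊗ Ω(T)`: it is represented by the factorization of `f` through
its supporting faces. -/
theorem mk_eq_of_isSupported (hS : S.IsOpen) (hT : T.IsOpen) (hφ : IsSupported φ)
    (hψ : IsSupported ψ) {R : Tree} (z : TensorPre A B R) {f : R.operad ⟶ bv S T}
    (hz : z.f ≫ bvTensorMap (φ.app _ z.x) (ψ.app _ z.y) = f)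
    {a : A.obj (.op (fstFace hS hT f))} {b : B.obj (.op (sndFace hS hT f))}
    (ha : φ.app _ a = fstι hS hT f) (hb : ψ.app _ b = sndι hS hT f)
    {g : R.operad ⟶ bv (fstFace hS hT f) (sndFace hS hT f)}
    (hg : g ≫ bvTensorMap (fstι hS hT f) (sndι hS hT f) = f) :
    Quot.mk (TensorRel A B R) z = Quot.mk _ ⟨_, _, a, b, g⟩ := by
  obtain ⟨S', T', x, y, k⟩ := z
  let x' : S' ⟶ S := φ.app _ x
  let y' : T' ⟶ T := ψ.app _ y
  replace hz : k ≫ bvTensorMap x' y' = f := hz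
  have hS' : S'.IsOpen := isOpen_of_treeHom hS x'
  have hT' : T'.IsOpen := isOpen_of_treeHom hT y'
  have hfk (e) : edgeMap f e = (Hom.colour x' (edgeMap k e).1, Hom.colour y' (edgeMap k e).2) :=
    (congrFun (congrArg Hom.colour hz) e).symm
  obtain ⟨l, hl⟩ := exists_face_lift hS' hT' k
  -- the maps `x'` and `y'` restrict to maps between the supporting faces of `k` and of `f`
  obtain ⟨u, hu⟩ : ∃ u, u ≫ fstι hS hT f = fstι hS' hT' k ≫ x' := by
    refine exists_treeHom_lift hS (fstι_injective hS hT f) _ ?_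
    rintro ⟨-, e, rfl⟩
    exact ⟨⟨_, e, rfl⟩, congrArg Prod.fst (hfk e)⟩
  obtain ⟨v, hv⟩ : ∃ v, v ≫ sndι hS hT f = sndι hS' hT' k ≫ y' := by
    refine exists_treeHom_lift hT (sndι_injective hS hT f) _ ?_
    rintro ⟨-, e, rfl⟩
    exact ⟨⟨_, e, rfl⟩, congrArg Prod.snd (hfk e)⟩
  have hx : A.map (fstι hS' hT' k).op x = A.map u.op a := by
    apply hφ.injective
    rw [NatTrans.naturality_apply, NatTrans.naturality_apply, ha]
    exact hu.symm
  have hy : B.map (sndι hS' hT' k).op y = B.map v.op b := by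
    apply hψ.injective
    rw [NatTrans.naturality_apply, NatTrans.naturality_apply, hb]
    exact hv.symm
  have huv : bvTensorMap u v ≫ bvTensorMap (fstι hS hT f) (sndι hS hT f) =
      bvTensorMap (fstι hS' hT' k) (sndι hS' hT' k) ≫ bvTensorMap x' y' :=
    (bvTensorMap_comp u _ v _).symm.trans
      ((congrArg₂ bvTensorMap hu hv).trans (bvTensorMap_comp _ x' _ y'))
  have hg' : g = l ≫ bvTensorMap u v := by
    refine (isCutOperad_bv (Tree.face_isOpen _) (Tree.face_isOpen _)).eq_of_comp_eq
      (isCompatEmbedding_bvTensorMap hS hT (fstι_injective hS hT f) (sndι_injective hS hT f))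
      (hg.trans (hz.symm.trans ?_))
    exact (congrArg (· ≫ bvTensorMap x' y') hl.symm).trans <|
      (Category.assoc l _ _).trans <| (congrArg (l ≫ ·) huv.symm).trans (Category.assoc l _ _).symm
  have h₁ := Quot.sound (TensorRel.mk (R := R) (fstι hS' hT' k) (sndι hS' hT' k) x y l)
  have h₂ := Quot.sound (TensorRel.mk (R := R) u v a b l)
  rw [hx, hy] at h₁
  refine .trans ?_ (h₁.symm.trans (h₂.trans ?_))
  · exact congrArg (fun k => Quot.mk _ (TensorPre.mk S' T' x y k)) hl.symm
  · exact congrArg (fun k => Quot.mk _ (TensorPre.mk _ _ a b k)) hg'.symm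

/-- If the tensor product of `φ` and `ψ` contains a dendrex with underlying map `f`, then `φ` and
`ψ` contain the inclusions of the supporting faces of `f`. -/
theorem exists_support (hS : S.IsOpen) (hT : T.IsOpen) (hφ : IsSupported φ) (hψ : IsSupported ψ)
    {R : Tree} (z : TensorPre A B R) {f : R.operad ⟶ bv S T}
    (hz : z.f ≫ bvTensorMap (φ.app _ z.x) (ψ.app _ z.y) = f) :
    (∃ a : A.obj (.op (fstFace hS hT f)), φ.app _ a = fstι hS hT f) ∧
      ∃ b : B.obj (.op (sndFace hS hT f)), ψ.app _ b = sndι hS hT f := by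
  have hfk (e) := (congrFun (congrArg Hom.colour hz) e)
  refine ⟨hφ.exists_app_eq (fstι_injective hS hT f) z.x ?_,
    hψ.exists_app_eq (sndι_injective hS hT f) z.y ?_⟩
  · rintro ⟨-, e, rfl⟩
    exact ⟨(edgeMap z.f e).1, congrArg Prod.fst (hfk e)⟩
  · rintro ⟨-, e, rfl⟩
    exact ⟨(edgeMap z.f e).2, congrArg Prod.snd (hfk e)⟩

theorem tensorMap_injective (hS : S.IsOpen) (hT : T.IsOpen) (hφ : IsSupported φ)
    (hψ : IsSupported ψ) (R : Tree) :
    Function.Injective ((tensorMap φ ψ).app (.op R)) := by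
  rintro ⟨z⟩ ⟨z'⟩ h
  have h' := congrArg evalTensor h
  obtain ⟨⟨a, ha⟩, b, hb⟩ := exists_support hS hT hφ hψ z rfl
  obtain ⟨g, hg⟩ := exists_face_lift hS hT
    (z.f ≫ bvTensorMap (φ.app _ z.x : _ ⟶ S) (ψ.app _ z.y : _ ⟶ T))
  exact (mk_eq_of_isSupported hS hT hφ hψ z rfl ha hb hg).trans
    (mk_eq_of_isSupported hS hT hφ hψ z' h'.symm ha hb hg).symm

/-- Dendrices of `A ⊗ Ω[T]` and `Ω[S] ⊗ B` with the same image in `Ω[S] ⊗ Ω[T]` come from a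
dendrex of `A ⊗ B`. -/
theorem exists_of_tensorMap_eq (hS : S.IsOpen) (hT : T.IsOpen) (hφ : IsSupported φ)
    (hψ : IsSupported ψ) {R : Tree} (z : (tensorObj A (representable T)).obj (.op R))
    (z' : (tensorObj (representable S) B).obj (.op R))
    (h : (tensorMap φ (𝟙 _)).app (.op R) z = (tensorMap (𝟙 _) ψ).app (.op R) z') :
    ∃ w : (tensorObj A B).obj (.op R),
      (tensorMap (𝟙 _) ψ).app (.op R) w = z ∧ (tensorMap φ (𝟙 _)).app (.op R) w = z' := by
  obtain ⟨z⟩ := z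
  obtain ⟨z'⟩ := z'
  have h' := congrArg evalTensor h
  obtain ⟨⟨a, ha⟩, -⟩ := exists_support hS hT hφ (isSupported_id T) z rfl
  obtain ⟨-, b, hb⟩ := exists_support hS hT (isSupported_id S) hψ z' h'.symm
  obtain ⟨g, hg⟩ := exists_face_lift hS hT
    (z.f ≫ bvTensorMap (φ.app _ z.x : _ ⟶ S) (z.y : _ ⟶ T))
  refine ⟨Quot.mk _ ⟨_, _, a, b, g⟩, ?_, ?_⟩
  · exact (mk_eq_of_isSupported hS hT hφ (isSupported_id T) z rfl ha hb hg).symm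
  · exact (mk_eq_of_isSupported hS hT (isSupported_id S) hψ z' h'.symm ha hb hg).symm

theorem mono_pushoutProduct (hS : S.IsOpen) (hT : T.IsOpen) (hφ : IsSupported φ)
    (hψ : IsSupported ψ) : Mono (pushoutProduct φ ψ) := by
  rw [NatTrans.mono_iff_mono_app]
  rintro ⟨R⟩
  rw [mono_iff_injective]
  have hpo := (IsPushout.of_hasPushout ((tensor.map φ).app B) ((tensor.obj A).map ψ)).map
    ((evaluation _ _).obj (.op R))
  have hl (z) : (pushoutProduct φ ψ).app (.op R)
      ((Limits.pushout.inl ((tensor.map φ).app B) ((tensor.obj A).map ψ)).app (.op R) z) =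
        (tensorMap (𝟙 (representable S)) ψ).app (.op R) z :=
    congrArg (fun t : (tensor.obj (representable S)).obj B ⟶ _ => t.app (.op R) z)
      (Limits.pushout.inl_desc _ _ _)
  have hr (z) : (pushoutProduct φ ψ).app (.op R)
      ((Limits.pushout.inr ((tensor.map φ).app B) ((tensor.obj A).map ψ)).app (.op R) z) =
        (tensorMap φ (𝟙 (representable T))).app (.op R) z :=
    congrArg (fun t : (tensor.obj A).obj (representable T) ⟶ _ => t.app (.op R) z)
      (Limits.pushout.inr_desc _ _ _)
  have hlr (z : (tensorObj (representable S) B).obj (.op R))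
      (z' : (tensorObj A (representable T)).obj (.op R))
      (h : (tensorMap φ (𝟙 (representable T))).app (.op R) z' =
        (tensorMap (𝟙 (representable S)) ψ).app (.op R) z) :
      (Limits.pushout.inl ((tensor.map φ).app B) ((tensor.obj A).map ψ)).app (.op R) z =
        (Limits.pushout.inr ((tensor.map φ).app B) ((tensor.obj A).map ψ)).app (.op R) z' := by
    obtain ⟨w, rfl, rfl⟩ := exists_of_tensorMap_eq hS hT hφ hψ z' z h
    exact ConcreteCategory.congr_hom hpo.w w
  intro p p' h
  rcases Limits.Types.eq_or_eq_of_isPushout hpo p with ⟨z, rfl⟩ | ⟨z, rfl⟩ <;>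
    rcases Limits.Types.eq_or_eq_of_isPushout hpo p' with ⟨z', rfl⟩ | ⟨z', rfl⟩
  · exact congrArg _ (tensorMap_injective hS hT (isSupported_id S) hψ R
      ((hl z).symm.trans (h.trans (hl z'))))
  · exact hlr z z' ((hr z').symm.trans (h.symm.trans (hl z)))
  · exact (hlr z' z ((hr z).symm.trans (h.trans (hl z')))).symm
  · exact congrArg _ (tensorMap_injective hS hT hφ (isSupported_id T) R
      ((hr z).symm.trans (h.trans (hr z'))))

theorem isNormal_tensor (hS : S.IsOpen) (hT : T.IsOpen) :
    IsNormal ((tensor.obj (representable S)).obj (representable T)) := by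
  intro R z σ hz
  have h : treeOperad.map σ.hom ≫ evalTensor z = evalTensor z := by
    refine .trans ?_ (congrArg evalTensor hz)
    obtain ⟨z⟩ := z
    rfl
  have hO := isCutOperad_bv hS hT
  have hR := isCutOperad_tree (isOpen_of_hom hO (evalTensor z))
  refine Iso.ext (hR.hom_ext (funext fun e => ?_))
  exact edgeMap_eq_self hO (evalTensor z) σ.hom σ.inv σ.inv_hom_id σ.hom_inv_id h e

end Tensor

end Dendroidal

theorem mainTheorem5 (S T : Dendroidal.Tree) (hS : S.IsOpen) (hT : T.IsOpen) :
    CategoryTheory.Mono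
        (Dendroidal.pushoutProduct (Dendroidal.boundary S).ι (Dendroidal.boundary T).ι) ∧
      Dendroidal.IsNormal
        ((Dendroidal.tensor.obj (Dendroidal.representable S)).obj (Dendroidal.representable T)) ∧
      Dendroidal.IsNormalMono
        (Dendroidal.pushoutProduct (Dendroidal.boundary S).ι (Dendroidal.boundary T).ι) := by
  have hmono := Dendroidal.mono_pushoutProduct hS hT (Dendroidal.isSupported_boundary hS)
    (Dendroidal.isSupported_boundary hT)
  have hnormal := Dendroidal.isNormal_tensor hS hT
  exact ⟨hmono, hnormal, hmono, fun R y _ σ hσ => hnormal R y σ hσ⟩
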